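/- **Setting.** For $f:\mathbb R^2\to\mathbb C$ let $\widehat f(k)=\int_{\mathbb R^2}f(x)e^{-ik\cdot x}\,dx$, and let $e^{it\Delta}$ be the Fourier multiplier $e^{-it|k|^2}$. Let $\eta:\mathbb R^2\to\mathbb C$ be smooth with compact support, and for $L,h,\sigma>0$ put $\mathbb Z_L^2=\{(n_1/L,n_2/L):n_1,n_2\in\mathbb Z\}$, $\eta_K=\eta(K)$, $$\varphi(x)=\frac1{(2\pi)^2}e^{-\frac12h^2|x|^2}\sum_{K\in\mathbb Z_L^2}\eta_Ke^{iK\cdot x},\qquad V^1(t)=\int_0^te^{-is\Delta}\big(|e^{is\Delta}\varphi|^2e^{is\Delta}\varphi\big)\,ds ,$$ $$\langle v\rangle_{K,\sigma}=\int_{\mathbb R^2}e^{-\frac{1}{2\sigma^2}|k-K|^2}\,\widehat v(k)\,dk ,\qquad \Delta\omega_{k\ell mj}=|k|^2+|m|^2-|\ell|^2-|j|^2 .$$ ($V^1$ is the first-order term in the expansion of $e^{-it\Delta}u(t)$ where $i\partial_tu=-\Delta u+|u|^2u$, $u(0)=\varphi$.) A family of positive parameters $(h,L,\sigma)$ is in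 the asymptotic regime (AR) if $L\to\infty$, $hL^{4+\delta_0}\le1$ for some fixed $\delta_0>0$, and $hL\ll\sigma\le h^{3/4}$. **Proposition.** For $K\in\mathbb Z_L^2$ and $t\ge0$ write $$\langle V^1(t)\rangle_{K,\sigma}=\frac1{(2\pi)^4}\sum_{K=K_1-K_2+K_3}\eta_{K_1}\overline{\eta_{K_2}}\eta_{K_3}\,\frac{1-e^{-it\Delta\omega_{K_1K_2K_3K}}}{i\Delta\omega_{K_1K_2K_3K}}+r_K(t,\eta),$$ the sum being over $K_1,K_2,K_3\in\mathbb Z_L^2$, with the convention $\frac{1-e^{-it0}}{i0}=t$. Note that $\Delta\omega_{K_1K_2K_3K}=|K_1|^2-|K_2|^2+|K_3|^2-|K|^2$. 1. There is a constant $C>0$ depending only on $\eta$, and for every $\delta>0$ a constant $C_\delta>0$ depending only on $\eta$ and $\delta$, such that in every family in the regime (AR) one has eventually (for $L$ large enough and $hL/\sigma$ small enough), for all $K\in\mathbb Z_L^2$ and all $0\le t\le\frac1{\sigma^2L^2}$, $$\begin{aligned}|r_K(t,\eta)|\le{}&CL^6e^{-\frac1{2\sigma^2L^2}+C\left(t+\frac{h^2}{\sigma^4}\right)}+CtL^2\log(L)\Big(\frac{h^2}{\sigma^2}+t\sigma^2+t^2h^2+t^3\sigma^4\Big)\\&+C_\delta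 L^{4+\delta}\Big(\frac{h^2}{\sigma^2}+t\sigma^2+t^2\sigma^2+t^3\sigma^4\Big).\end{aligned}$$ 2. In the regime (AR), for $K\in\mathbb Z_L^2$ and $t\ge0$ possibly varying with the parameters, $$t\ll\frac1h\quad\Longrightarrow\quad|r_K(t,\eta)|\ll tL^2\log(L)+L^4 .$$ -/

import Mathlib

open Filter Topology MeasureTheory Asymptotics

namespace CoarseNLS

noncomputable section

/-- The Euclidean plane. -/
abbrev Plane : Type := EuclideanSpace ℝ (Fin 2)

/-- The Fourier transform, `f̂(k) = ∫ f(x) e^{-i k·x} dx`. -/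
def fourier (f : Plane → ℂ) (k : Plane) : ℂ :=
  ∫ x : Plane, f x * Complex.exp (-(Complex.I * ((inner ℝ k x : ℝ) : ℂ)))

/-- The inverse Fourier transform, `(2π)⁻² ∫ f(k) e^{i k·x} dk`. -/
def invFourier (f : Plane → ℂ) (x : Plane) : ℂ :=
  (1 / (2 * (Real.pi : ℂ)) ^ 2) *
    ∫ k : Plane, f k * Complex.exp (Complex.I * ((inner ℝ k x : ℝ) : ℂ))

/-- The free Schrödinger propagator `e^{itΔ}`, the Fourier multiplier `e^{-it|k|²}`. -/
def propagator (t : ℝ) (f : Plane → ℂ) : Plane → ℂ :=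
  invFourier fun k => Complex.exp (-(Complex.I * (t : ℂ) * (((‖k‖ ^ 2 : ℝ)) : ℂ))) * fourier f k

/-- The lattice `ℤ_L²` of mesh `1 / L`, as a set of points of the plane. -/
def lattice (L : ℝ) : Set Plane :=
  {K | ∃ n : Fin 2 → ℤ, ∀ j, K j = (n j : ℝ) / L}

/-- The Gaussian wave packet `g_{K,ε}(x) = (2π)⁻² e^{i K·x} e^{-ε²|x|²/2}`. -/
def gauss (K : Plane) (ε : ℝ) (x : Plane) : ℂ :=
  (1 / (2 * (Real.pi : ℂ)) ^ 2) * Complex.exp (Complex.I * ((inner ℝ K x : ℝ) : ℂ)) *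
    ((Real.exp (-(1 / 2) * ε ^ 2 * ‖x‖ ^ 2) : ℝ) : ℂ)

/-- The initial datum `φ = ∑_{K ∈ ℤ_L²} η(K) g_{K,h}`. The sum has finitely many nonzero terms
when `η` has compact support and `L > 0`. -/
def initialDatum (η : Plane → ℂ) (h L : ℝ) (x : Plane) : ℂ :=
  ∑' K : lattice L, η K * gauss K h x

/-- The first order (cubic) term in the expansion of `v(t) = e^{-itΔ} u(t)`, where `u` solves
`i ∂ₜ u = -Δ u + |u|² u` with `u(0) = φ`:
`V¹(t) = ∫₀ᵗ e^{-isΔ} ( |e^{isΔ} φ|² e^{isΔ} φ ) ds`. -/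
def firstOrder (φ : Plane → ℂ) (t : ℝ) (x : Plane) : ℂ :=
  ∫ s in (0 : ℝ)..t,
    propagator (-s)
      (fun y => ((‖propagator s φ y‖ ^ 2 : ℝ) : ℂ) * propagator s φ y) x

/-- The coarse grained quantity `⟨v⟩_{K,σ} = ∫ e^{-|k-K|²/(2σ²)} v̂(k) dk`. -/
def coarse (v : Plane → ℂ) (K : Plane) (σ : ℝ) : ℂ :=
  ∫ k : Plane, ((Real.exp (-(1 / (2 * σ ^ 2)) * ‖k - K‖ ^ 2) : ℝ) : ℂ) * fourier v k

/-- `Δω_{kℓmj} = |k|² + |m|² - |ℓ|² - |j|²`. -/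
def resonance (k l m j : Plane) : ℝ :=
  ‖k‖ ^ 2 + ‖m‖ ^ 2 - ‖l‖ ^ 2 - ‖j‖ ^ 2

/-- `(1 - e^{-itω}) / (iω)`, with the convention that the value at `ω = 0` is `t`. -/
def oscillation (t ω : ℝ) : ℂ :=
  if ω = 0 then (t : ℂ)
  else (1 - Complex.exp (-(Complex.I * (t : ℂ) * (ω : ℂ)))) / (Complex.I * (ω : ℂ))

/-- The triples `(K₁, K₂, K₃)` of lattice points with `K = K₁ - K₂ + K₃`. -/
def interactions (L : ℝ) (K : Plane) : Set (Plane × Plane × Plane) :=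
  {p | p.1 ∈ lattice L ∧ p.2.1 ∈ lattice L ∧ p.2.2 ∈ lattice L ∧ K = p.1 - p.2.1 + p.2.2}

/-- The sum over `K = K₁ - K₂ + K₃` of `η(K₁) conj(η(K₂)) η(K₃) (1 - e^{-itΔω}) / (iΔω)`, with
`Δω = Δω_{K₁K₂K₃K} = |K₁|² - |K₂|² + |K₃|² - |K|²`. -/
def interactionSum (η : Plane → ℂ) (L : ℝ) (K : Plane) (t : ℝ) : ℂ :=
  ∑' p : interactions L K,
    η p.1.1 * (starRingEnd ℂ) (η p.1.2.1) * η p.1.2.2 *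
      oscillation t (resonance p.1.1 p.1.2.1 p.1.2.2 K)

/-- The asymptotic regime (AR) for a family of parameters `(h, L, σ)` along a filter:
`L ≫ 1`, `h L^{4+δ₀} ≤ 1` for some `δ₀ > 0`, and `h L ≪ σ ≤ h^{3/4}`. -/
structure AsymptoticRegime {ι : Type*} (l : Filter ι) (h L σ : ι → ℝ) : Prop where
  pos : ∀ᶠ i in l, 0 < h i ∧ 0 < L i ∧ 0 < σ i
  large : Tendsto L l atTop
  truncation : ∃ δ₀ : ℝ, 0 < δ₀ ∧ ∀ᶠ i in l, h i * L i ^ (4 + δ₀) ≤ 1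
  lower : (fun i => h i * L i) =o[l] σ
  upper : ∀ᶠ i in l, σ i ≤ h i ^ (3 / 4 : ℝ)

end

end CoarseNLS

namespace CoarseNLS

noncomputable section

/-! Everything before the estimates is an exact Gaussian computation. Free evolution, products,
complex conjugation and the Fourier transform all preserve the class of complex Gaussians, and
coarse graining is one more Gaussian integral. With `η` compactly supported only finitely many
packets occur, so `coarse_firstOrder` writes the coarse-grained cubic term as a finite sum over
triples of `∫ s in 0..t, packet h σ K p s`, where `packet` is explicit. Put P = K₁ - K₂ + K₃ - K.

If P ≠ 0, then |P| ≥ 1/L. The real part of the exponent is -|P|²/(2σ²) up to errors controlled by t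
and h²/σ⁴, so each of the O(L⁶) such triples is exponentially small (`re_exponent_le`,
`norm_integral_packet_le`).

If P = 0, the packet is exp(-isΔω) times a factor 1 + `deviation`. Integrating exp(-isΔω) alone
gives the term of the discrete sum. The deviation is small together with its derivative
(`C1Bound_deviation`), so a trivial bound when Δω = 0 and an integration by parts when Δω ≠ 0 give
an error E·(t·1_{Δω=0} + 1/|Δω|), up to a constant, with E = h²/σ² + th² + t²h²
(`norm_integral_packet_sub_le`).

It remains to sum over P = 0. Writing K₁ = K + n/L and K₃ = K + m/L gives Δω = -2 n·m/L². The exact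
resonances are the orthogonal pairs of integer vectors of size O(L), of which there are O(L² log L)
(`card_orthPairs_le`). The sum of 1/|n·m| over the others is O(L² log² L) (`sum_sum_inv_le`): it is
a correlation of the number of factorizations of an integer, and the second moment of that number is
again a count of orthogonal pairs.

The resulting bound (`exists_norm_remainder_le`) is sharper than the stated one. Part 1 follows from
h ≤ σ and log² L ≤ C_δ L^δ; part 2 follows directly from the sharper bound once σ²L² ≤ h is noted,
which puts every t ≪ 1/h in the admissible time range. -/

/-! ### Complex Gaussians under the Fourier transform, the free flow and coarse graining -/

/-- The complex Gaussian `exp (-A |x|² + a x₀ + b x₁)` on the plane. -/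
def gexp (A a b : ℂ) (x : Plane) : ℂ :=
  Complex.exp (-A * ((x 0 : ℂ) ^ 2 + (x 1 : ℂ) ^ 2) + (a * x 0 + b * x 1))

lemma integrable_gexp {A : ℂ} (hA : 0 < A.re) (a b : ℂ) : Integrable (gexp A a b) := by
  have h := GaussianFourier.integrable_cexp_neg_mul_sum_add hA ![a, b]
  rw [← (PiLp.volume_preserving_ofLp (Fin 2)).integrable_comp_emb
    (MeasurableEquiv.toLp 2 (Fin 2 → ℝ)).symm.measurableEmbedding] at h
  refine h.congr (Eventually.of_forall fun x => ?_)
  simp [gexp, Fin.sum_univ_two]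

lemma integral_gexp {A : ℂ} (hA : 0 < A.re) (a b : ℂ) :
    ∫ x, gexp A a b x = Real.pi / A * Complex.exp ((a ^ 2 + b ^ 2) / (4 * A)) := by
  have h := GaussianFourier.integral_cexp_neg_mul_sum_add hA ![a, b]
  rw [← (PiLp.volume_preserving_ofLp (Fin 2)).integral_comp
    (MeasurableEquiv.toLp 2 (Fin 2 → ℝ)).symm.measurableEmbedding] at h
  simpa [gexp, Fin.sum_univ_two] using h

lemma gexp_mul (A a b A' a' b' : ℂ) (x : Plane) :
    gexp A a b x * gexp A' a' b' x = gexp (A + A') (a + a') (b + b') x := by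
  simp only [gexp, ← Complex.exp_add]
  congr 1
  ring

lemma conj_gexp (A a b : ℂ) (x : Plane) :
    (starRingEnd ℂ) (gexp A a b x) =
      gexp ((starRingEnd ℂ) A) ((starRingEnd ℂ) a) ((starRingEnd ℂ) b) x := by
  simp [gexp, ← Complex.exp_conj]

lemma inner_eq (k x : Plane) : inner ℝ k x = k 0 * x 0 + k 1 * x 1 := by
  simp [PiLp.inner_apply, Fin.sum_univ_two, mul_comm]

lemma norm_sq_eq (x : Plane) : ‖x‖ ^ 2 = x 0 ^ 2 + x 1 ^ 2 := by
  simp [EuclideanSpace.norm_sq_eq, Fin.sum_univ_two]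

lemma exp_inner_eq_gexp (k x : Plane) :
    Complex.exp (-(Complex.I * ((inner ℝ k x : ℝ) : ℂ))) =
      gexp 0 (-Complex.I * k 0) (-Complex.I * k 1) x := by
  rw [gexp, inner_eq]; push_cast; congr 1; ring

lemma exp_inner_eq_gexp' (k x : Plane) :
    Complex.exp (Complex.I * ((inner ℝ k x : ℝ) : ℂ)) =
      gexp 0 (Complex.I * x 0) (Complex.I * x 1) k := by
  rw [gexp, inner_eq]; push_cast; congr 1; ring

lemma re_one_div_four_mul {A : ℂ} (hA : 0 < A.re) : 0 < (1 / (4 * A)).re := by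
  have h0 : A ≠ 0 := fun h => by simp [h] at hA
  rw [one_div, Complex.inv_re]
  have : 0 < Complex.normSq (4 * A) := Complex.normSq_pos.2 (by simp [h0])
  refine div_pos ?_ this
  simpa using hA

/-- A single quadratic coefficient `A` for the whole sum is enough: at each time all packets, and
all triple products of packets, have the same width. Only the linear coefficients depend on the
index. -/
lemma fourier_sum_gexp {ι : Type*} (S : Finset ι) (γ : ι → ℂ) {A : ℂ} (hA : 0 < A.re)
    (a b : ι → ℂ) (k : Plane) :
    fourier (fun x => ∑ i ∈ S, γ i * gexp A (a i) (b i) x) k =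
      ∑ i ∈ S, γ i * (Real.pi / A * Complex.exp ((a i ^ 2 + b i ^ 2) / (4 * A))) *
        gexp (1 / (4 * A)) (-Complex.I * a i / (2 * A)) (-Complex.I * b i / (2 * A)) k := by
  have h0 : A ≠ 0 := fun h => by simp [h] at hA
  unfold fourier
  simp_rw [exp_inner_eq_gexp, Finset.sum_mul, mul_assoc, gexp_mul]
  rw [integral_finsetSum]
  · refine Finset.sum_congr rfl fun i _ => ?_
    rw [integral_const_mul, integral_gexp (by simpa using hA)]
    simp only [add_zero, gexp, ← Complex.exp_add]
    congr 4
    field_simp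
    linear_combination 2 * ((k 0 : ℂ) ^ 2 + (k 1 : ℂ) ^ 2) * Complex.I_sq
  · intro i _
    exact (integrable_gexp (by simpa using hA) _ _).const_mul _

lemma invFourier_sum_gexp {ι : Type*} (S : Finset ι) (γ : ι → ℂ) {A : ℂ} (hA : 0 < A.re)
    (a b : ι → ℂ) (k : Plane) :
    invFourier (fun x => ∑ i ∈ S, γ i * gexp A (a i) (b i) x) k =
      ∑ i ∈ S, γ i * (1 / (4 * Real.pi * A) * Complex.exp ((a i ^ 2 + b i ^ 2) / (4 * A))) *
        gexp (1 / (4 * A)) (Complex.I * a i / (2 * A)) (Complex.I * b i / (2 * A)) k := by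
  have h0 : A ≠ 0 := fun h => by simp [h] at hA
  have hpi : (Real.pi : ℂ) ≠ 0 := by exact_mod_cast Real.pi_ne_zero
  unfold invFourier
  simp_rw [exp_inner_eq_gexp', Finset.sum_mul, mul_assoc, gexp_mul]
  rw [integral_finsetSum, Finset.mul_sum]
  · refine Finset.sum_congr rfl fun i _ => ?_
    rw [integral_const_mul, integral_gexp (by simpa using hA)]
    have : (1 / (2 * (Real.pi : ℂ)) ^ 2) * (γ i * (Real.pi / (A + 0) *
        Complex.exp (((a i + Complex.I * k 0) ^ 2 + (b i + Complex.I * k 1) ^ 2)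
          / (4 * (A + 0))))) =
        γ i * (1 / (4 * (Real.pi * A)) * 
        Complex.exp (((a i + Complex.I * k 0) ^ 2 + (b i + Complex.I * k 1) ^ 2)
          / (4 * A))) := by
      rw [add_zero]; field_simp; ring
    rw [this]
    simp only [gexp, ← Complex.exp_add]
    congr 3
    field_simp
    linear_combination 2 * ((k 0 : ℂ) ^ 2 + (k 1 : ℂ) ^ 2) * Complex.I_sq
  · intro i _
    exact (integrable_gexp (by simpa using hA) _ _).const_mul _

lemma one_add_ne_zero {A : ℂ} (hA : 0 < A.re) (s : ℝ) : 1 + 4 * Complex.I * s * A ≠ 0 := by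
  intro h
  have h0 : A ≠ 0 := fun h => by simp [h] at hA
  have h1 := re_one_div_four_mul hA
  have : 1 / (4 * A) = -(Complex.I * s) := by
    field_simp; linear_combination h
  rw [this] at h1
  simp at h1

/-- In the variable 1/(4A) the free flow is translation by `is`, and inversion preserves the right
half plane. Hence evolved Gaussians stay integrable at every time. -/
lemma re_div_pos {A : ℂ} (hA : 0 < A.re) (s : ℝ) :
    0 < (A / (1 + 4 * Complex.I * s * A)).re := by
  have h0 : A ≠ 0 := fun h => by simp [h] at hA
  have h1 := re_one_div_four_mul hA
  have h2 := one_add_ne_zero hA s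
  have h3 : 0 < (1 / (4 * A) + Complex.I * s).re := by simpa using h1
  have h4 := re_one_div_four_mul h3
  convert h4 using 2
  have : 4 * (1 / (4 * A) + Complex.I * s) = (1 + 4 * Complex.I * s * A) / A := by
    field_simp
  rw [this, one_div_div]

lemma propagator_sum_gexp {ι : Type*} (S : Finset ι) (γ : ι → ℂ) {A : ℂ} (hA : 0 < A.re)
    (a b : ι → ℂ) (s : ℝ) :
    propagator s (fun x => ∑ i ∈ S, γ i * gexp A (a i) (b i) x) = fun x =>
      ∑ i ∈ S, γ i * (1 / (1 + 4 * Complex.I * s * A) *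
          Complex.exp (Complex.I * s * (a i ^ 2 + b i ^ 2) / (1 + 4 * Complex.I * s * A))) *
        gexp (A / (1 + 4 * Complex.I * s * A)) (a i / (1 + 4 * Complex.I * s * A))
          (b i / (1 + 4 * Complex.I * s * A)) x := by
  have h0 : A ≠ 0 := fun h => by simp [h] at hA
  have hpi : (Real.pi : ℂ) ≠ 0 := by exact_mod_cast Real.pi_ne_zero
  have hq := one_add_ne_zero hA s
  set q := 1 + 4 * Complex.I * s * A with hqdef
  have hB : 0 < (1 / (4 * A) + Complex.I * s).re := by simpa using re_one_div_four_mul hA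
  have hBe : 1 / (4 * A) + Complex.I * s = q / (4 * A) := by rw [hqdef]; field_simp
  unfold propagator
  simp_rw [fourier_sum_gexp S γ hA]
  have : (fun k : Plane => Complex.exp (-(Complex.I * (s : ℂ) * (((‖k‖ ^ 2 : ℝ)) : ℂ))) *
      ∑ i ∈ S, γ i * (Real.pi / A * Complex.exp ((a i ^ 2 + b i ^ 2) / (4 * A))) *
        gexp (1 / (4 * A)) (-Complex.I * a i / (2 * A)) (-Complex.I * b i / (2 * A)) k) =
      fun k => ∑ i ∈ S, γ i * (Real.pi / A * Complex.exp ((a i ^ 2 + b i ^ 2) / (4 * A))) *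
        gexp (1 / (4 * A) + Complex.I * s) (-Complex.I * a i / (2 * A))
          (-Complex.I * b i / (2 * A)) k := by
    funext k
    rw [Finset.mul_sum]
    refine Finset.sum_congr rfl fun i _ => ?_
    rw [mul_left_comm]
    congr 1
    simp only [gexp, ← Complex.exp_add, norm_sq_eq]
    congr 1
    push_cast
    ring
  rw [this]
  funext x
  rw [invFourier_sum_gexp S _ hB]
  refine Finset.sum_congr rfl fun i _ => ?_
  rw [hBe]
  have e1 : 1 / (4 * (q / (4 * A))) = A / q := by field_simp
  have e2 : ∀ z : ℂ, Complex.I * (-Complex.I * z / (2 * A)) / (2 * (q / (4 * A))) = z / q := by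
    intro z
    field_simp
    linear_combination -4 * z * Complex.I_sq
  rw [e1, e2, e2]
  congr 1
  rw [mul_assoc]
  congr 1
  have e3 : Complex.exp (Complex.I * s * (a i ^ 2 + b i ^ 2) / q) =
      Complex.exp ((a i ^ 2 + b i ^ 2) / (4 * A)) *
      Complex.exp (((-Complex.I * a i / (2 * A)) ^ 2 + (-Complex.I * b i / (2 * A)) ^ 2) /
        (4 * (q / (4 * A)))) := by
    rw [← Complex.exp_add]
    congr 1
    field_simp
    rw [hqdef, Complex.I_sq]
    ring
  rw [e3]
  field_simp

/-- The test packet multiplies the Fourier transform by another Gaussian, so the denominator is that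
of the propagator with `is` replaced by 1/(2σ²). -/
lemma coarse_sum_gexp {ι : Type*} (S : Finset ι) (γ : ι → ℂ) {A : ℂ} (hA : 0 < A.re)
    (a b : ι → ℂ) (K : Plane) {σ : ℝ} (hσ : 0 < σ) :
    coarse (fun x => ∑ i ∈ S, γ i * gexp A (a i) (b i) x) K σ =
      ∑ i ∈ S, γ i * (4 * Real.pi ^ 2 / (1 + 4 * (1 / (2 * σ ^ 2)) * A) *
        Complex.exp (1 / (2 * σ ^ 2) * ((a i - Complex.I * K 0) ^ 2 + (b i - Complex.I * K 1) ^ 2)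
          / (1 + 4 * (1 / (2 * σ ^ 2)) * A))) := by
  have h0 : A ≠ 0 := fun h => by simp [h] at hA
  set β : ℝ := 1 / (2 * σ ^ 2) with hβ
  have hβ0 : 0 < β := by positivity
  have hβc : (1 / (2 * (σ : ℂ) ^ 2)) = (β : ℂ) := by rw [hβ]; push_cast; rfl
  rw [hβc]
  have hB : 0 < (1 / (4 * A) + β).re := by
    have := re_one_div_four_mul hA
    rw [Complex.add_re, Complex.ofReal_re]
    linarith
  have hBne : 1 / (4 * A) + β ≠ 0 := fun h => by rw [h, Complex.zero_re] at hB; exact lt_irrefl _ hB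
  have hQ : 1 + 4 * (β : ℂ) * A ≠ 0 := by
    intro h; apply hBne; field_simp; linear_combination h
  have hBe : 1 / (4 * A) + β = (1 + 4 * (β : ℂ) * A) / (4 * A) := by field_simp
  unfold coarse
  simp_rw [fourier_sum_gexp S γ hA]
  have hW : ∀ k : Plane, ((Real.exp (-(1 / (2 * σ ^ 2)) * ‖k - K‖ ^ 2) : ℝ) : ℂ) =
      Complex.exp (-(β * (K 0 ^ 2 + K 1 ^ 2))) * gexp β (2 * β * K 0) (2 * β * K 1) k := by
    intro k
    rw [norm_sq_eq, ← hβ, gexp, ← Complex.exp_add]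
    push_cast
    congr 1
    simp
    ring
  simp_rw [hW, Finset.mul_sum]
  rw [integral_finsetSum]
  · refine Finset.sum_congr rfl fun i _ => ?_
    have : ∀ k : Plane, Complex.exp (-(β * (K 0 ^ 2 + K 1 ^ 2))) *
        gexp β (2 * β * K 0) (2 * β * K 1) k *
        (γ i * (Real.pi / A * Complex.exp ((a i ^ 2 + b i ^ 2) / (4 * A))) *
        gexp (1 / (4 * A)) (-Complex.I * a i / (2 * A)) (-Complex.I * b i / (2 * A)) k) =
        (Complex.exp (-(β * (K 0 ^ 2 + K 1 ^ 2))) *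
        (γ i * (Real.pi / A * Complex.exp ((a i ^ 2 + b i ^ 2) / (4 * A))))) *
        gexp (1 / (4 * A) + β) (-Complex.I * a i / (2 * A) + 2 * β * K 0)
          (-Complex.I * b i / (2 * A) + 2 * β * K 1) k := by
      intro k
      rw [← gexp_mul]; ring
    simp_rw [this]
    rw [integral_const_mul, integral_gexp hB, hBe]
    set Q := 1 + 4 * (β : ℂ) * A with hQd
    have e3 : Complex.exp (β * ((a i - Complex.I * K 0) ^ 2 + (b i - Complex.I * K 1) ^ 2) / Q) =
        Complex.exp (-(β * (K 0 ^ 2 + K 1 ^ 2))) * Complex.exp ((a i ^ 2 + b i ^ 2) / (4 * A)) *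
        Complex.exp (((-Complex.I * a i / (2 * A) + 2 * β * K 0) ^ 2 +
          (-Complex.I * b i / (2 * A) + 2 * β * K 1) ^ 2) / (4 * (Q / (4 * A)))) := by
      rw [← Complex.exp_add, ← Complex.exp_add]
      congr 1
      field_simp
      rw [hQd]
      linear_combination 4 * (4 * A * β * ((K 0 : ℂ) ^ 2 + (K 1 : ℂ) ^ 2) - a i ^ 2 - b i ^ 2)
        * Complex.I_sq
    rw [e3]
    field_simp
  · intro i _
    have := ((integrable_gexp hB (-Complex.I * a i / (2 * A) + 2 * β * K 0)
      (-Complex.I * b i / (2 * A) + 2 * β * K 1)).const_mul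
      (Complex.exp (-(β * (K 0 ^ 2 + K 1 ^ 2))) *
        (γ i * (Real.pi / A * Complex.exp ((a i ^ 2 + b i ^ 2) / (4 * A))))))
    refine this.congr (Eventually.of_forall fun k => ?_)
    simp only
    rw [← gexp_mul]; ring

/-! ### Interchange of coarse graining and the time integral -/

/-- Half of the decay is spent on completing the square against the linear terms. This gives one
integrable majorant valid for all times in a compact interval. -/
lemma norm_gexp_le {A a b : ℂ} {m B : ℝ} (hm : 0 < m) (hA : 2 * m ≤ A.re) (ha : ‖a‖ ≤ B)
    (hb : ‖b‖ ≤ B) (x : Plane) :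
    ‖gexp A a b x‖ ≤ Real.exp (B ^ 2 / (2 * m)) * ‖gexp (m : ℂ) 0 0 x‖ := by
  have hre : ∀ A a b : ℂ, (-A * ((x 0 : ℂ) ^ 2 + (x 1 : ℂ) ^ 2) + (a * x 0 + b * x 1)).re =
      -A.re * ((x 0) ^ 2 + (x 1) ^ 2) + (a.re * x 0 + b.re * x 1) := by
    intro A a b
    simp [← Complex.ofReal_pow]
  have key : ∀ z : ℂ, ‖z‖ ≤ B → ∀ y : ℝ, z.re * y ≤ m * y ^ 2 + B ^ 2 / (4 * m) := by
    intro z hz y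
    have h1 : z.re ^ 2 ≤ B ^ 2 := by
      have := (Complex.abs_re_le_norm z).trans hz
      exact sq_le_sq' (by linarith [abs_le.1 this]) (abs_le.1 this).2
    have h2 : m * y ^ 2 + B ^ 2 / (4 * m) - z.re * y =
        (2 * m * y - z.re) ^ 2 / (4 * m) + (B ^ 2 - z.re ^ 2) / (4 * m) := by
      field_simp; ring
    have : 0 ≤ (2 * m * y - z.re) ^ 2 / (4 * m) + (B ^ 2 - z.re ^ 2) / (4 * m) := by
      have : 0 ≤ B ^ 2 - z.re ^ 2 := by linarith
      positivity
    linarith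
  rw [gexp, gexp, Complex.norm_exp, Complex.norm_exp, hre, hre, ← Real.exp_add]
  apply Real.exp_le_exp.2
  have h0 := key a ha (x 0)
  have h1 := key b hb (x 1)
  have h2 : B ^ 2 / (2 * m) = B ^ 2 / (4 * m) + B ^ 2 / (4 * m) := by field_simp; ring
  simp only [Complex.ofReal_re, Complex.zero_re]
  nlinarith [sq_nonneg (x 0), sq_nonneg (x 1)]

/-- Exchange of the coarse graining with a time integral of dominated functions. -/
lemma coarse_integral {F : ℝ → Plane → ℂ} (hF : Continuous (Function.uncurry F)) {t : ℝ}
    (ht : 0 ≤ t) {g : Plane → ℝ} (hg : Integrable g)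
    (hb : ∀ s ∈ Set.Ioc 0 t, ∀ x, ‖F s x‖ ≤ g x) (K : Plane) {σ : ℝ} (hσ : 0 < σ) :
    coarse (fun x => ∫ s in (0 : ℝ)..t, F s x) K σ = ∫ s in (0 : ℝ)..t, coarse (F s) K σ := by
  simp_rw [intervalIntegral.integral_of_le ht]
  set μ : Measure ℝ := volume.restrict (Set.Ioc 0 t) with hμ
  have hfou : ∀ k, fourier (fun x => ∫ s, F s x ∂μ) k = ∫ s, fourier (F s) k ∂μ := by
    intro k
    unfold fourier
    simp_rw [← integral_mul_const]
    rw [integral_integral_swap]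
    have : Integrable (fun p : Plane × ℝ => g p.1 * 1) (volume.prod μ) :=
      hg.mul_prod (integrable_const (1 : ℝ))
    refine this.mono' ?_ ?_
    · refine Continuous.aestronglyMeasurable ?_
      have : Continuous fun p : Plane × ℝ => Function.uncurry F (p.2, p.1) := by fun_prop
      simp only [Function.uncurry] at this ⊢
      fun_prop
    · have : ∀ᵐ p ∂((volume : Measure Plane).prod μ), p.2 ∈ Set.Ioc 0 t :=
        Measure.quasiMeasurePreserving_snd.ae (ae_restrict_mem measurableSet_Ioc)
      filter_upwards [this] with p hp
      have h1 : ‖Complex.exp (-(Complex.I * ((inner ℝ k p.1 : ℝ) : ℂ)))‖ = 1 := by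
        rw [Complex.norm_exp]; simp
      rw [Function.uncurry, norm_mul, h1]
      simpa using hb _ hp _
  unfold coarse
  simp_rw [hfou, ← integral_const_mul]
  rw [integral_integral_swap]
  have hWi : Integrable fun k : Plane => Real.exp (-(1 / (2 * σ ^ 2)) * ‖k - K‖ ^ 2) := by
    have h := (GaussianFourier.integrable_cexp_neg_mul_sq_norm_add (V := Plane)
      (b := ((1 / (2 * σ ^ 2) : ℝ) : ℂ)) (by rw [Complex.ofReal_re]; positivity) 0 0).norm
    have := h.comp_sub_right K
    refine this.congr (Eventually.of_forall fun k => ?_)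
    simp only [Complex.norm_exp]
    congr 1
    simp [← Complex.ofReal_pow, ← Complex.ofReal_mul]
  have hdom : Integrable (fun p : Plane × ℝ => Real.exp (-(1 / (2 * σ ^ 2)) * ‖p.1 - K‖ ^ 2) *
      ∫ x, g x) (volume.prod μ) := hWi.mul_prod (integrable_const (∫ x, g x))
  refine hdom.mono' ?_ ?_
  · have h1 : AEStronglyMeasurable (fun p : Plane × ℝ => fourier (F p.2) p.1)
        (volume.prod μ) := by
      have : StronglyMeasurable (fun q : (Plane × ℝ) × Plane =>
          F q.1.2 q.2 * Complex.exp (-(Complex.I * ((inner ℝ q.1.1 q.2 : ℝ) : ℂ)))) := by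
        refine Continuous.stronglyMeasurable ?_
        have : Continuous fun q : (Plane × ℝ) × Plane => Function.uncurry F (q.1.2, q.2) := by
          fun_prop
        simp only [Function.uncurry] at this
        fun_prop
      exact (this.integral_prod_right' (ν := volume)).aestronglyMeasurable
    refine AEStronglyMeasurable.mul ?_ h1
    exact Continuous.aestronglyMeasurable (by fun_prop)
  · have : ∀ᵐ p ∂((volume : Measure Plane).prod μ), p.2 ∈ Set.Ioc 0 t :=
      Measure.quasiMeasurePreserving_snd.ae (ae_restrict_mem measurableSet_Ioc)
    filter_upwards [this] with p hp
    rw [Function.uncurry, norm_mul, Complex.norm_real, Real.norm_of_nonneg (Real.exp_pos _).le]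
    refine mul_le_mul_of_nonneg_left ?_ (Real.exp_pos _).le
    unfold fourier
    refine norm_integral_le_of_norm_le hg (Eventually.of_forall fun x => ?_)
    have h1 : ‖Complex.exp (-(Complex.I * ((inner ℝ p.1 x : ℝ) : ℂ)))‖ = 1 := by
      rw [Complex.norm_exp]; simp
    rw [norm_mul, h1, mul_one]
    exact hb _ hp _

lemma coarse_integral_gexp {ι : Type*} (S : Finset ι) {Γ a b : ι → ℝ → ℂ} {A : ℝ → ℂ}
    (hΓ : ∀ i, Continuous (Γ i)) (ha : ∀ i, Continuous (a i)) (hb : ∀ i, Continuous (b i))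
    (hA : Continuous A) (hpos : ∀ s, 0 < (A s).re) {t : ℝ} (ht : 0 ≤ t) (K : Plane) {σ : ℝ}
    (hσ : 0 < σ) :
    coarse (fun x => ∫ s in (0 : ℝ)..t, ∑ i ∈ S, Γ i s * gexp (A s) (a i s) (b i s) x) K σ =
      ∑ i ∈ S, ∫ s in (0 : ℝ)..t, Γ i s * (4 * Real.pi ^ 2 / (1 + 4 * (1 / (2 * σ ^ 2)) * A s) *
        Complex.exp (1 / (2 * σ ^ 2) *
          ((a i s - Complex.I * K 0) ^ 2 + (b i s - Complex.I * K 1) ^ 2)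
          / (1 + 4 * (1 / (2 * σ ^ 2)) * A s))) := by
  have hcompact : IsCompact (Set.Icc 0 t) := isCompact_Icc
  have hne : (Set.Icc 0 t).Nonempty := Set.nonempty_Icc.2 ht
  obtain ⟨s0, -, hs0⟩ := hcompact.exists_isMinOn hne (Complex.continuous_re.comp hA).continuousOn
  set m := (A s0).re / 2 with hm
  have hmpos : 0 < m := by have := hpos s0; positivity
  have hmle : ∀ s ∈ Set.Icc 0 t, 2 * m ≤ (A s).re := by
    intro s hs
    have : (A s0).re ≤ (A s).re := hs0 hs
    rw [hm]; linarith
  choose B hB using fun i => hcompact.exists_bound_of_continuousOn (ha i).continuousOn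
  choose B' hB' using fun i => hcompact.exists_bound_of_continuousOn (hb i).continuousOn
  choose G hG using fun i => hcompact.exists_bound_of_continuousOn (hΓ i).continuousOn
  have hint : Integrable fun x : Plane => ∑ i ∈ S,
      G i * (Real.exp ((max (B i) (B' i)) ^ 2 / (2 * m)) * ‖gexp (m : ℂ) 0 0 x‖) := by
    refine integrable_finsetSum _ fun i _ => ?_
    exact ((integrable_gexp (by simpa using hmpos) 0 0).norm.const_mul _).const_mul _
  rw [coarse_integral (F := fun s x => ∑ i ∈ S, Γ i s * gexp (A s) (a i s) (b i s) x) ?_ ht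
    hint ?_ K hσ]
  · simp_rw [coarse_sum_gexp S (fun i => Γ i _) (hpos _) (fun i => a i _) (fun i => b i _) K hσ]
    rw [intervalIntegral.integral_finsetSum]
    intro i _
    refine Continuous.intervalIntegrable ?_ _ _
    have hQ : ∀ s, 1 + 4 * (1 / (2 * (σ : ℂ) ^ 2)) * A s ≠ 0 := by
      intro s h
      have h1 : (1 + 4 * (1 / (2 * (σ : ℂ) ^ 2)) * A s).re =
          1 + 4 * (1 / (2 * σ ^ 2)) * (A s).re := by
        have : 4 * (1 / (2 * (σ : ℂ) ^ 2)) = ((4 * (1 / (2 * σ ^ 2)) : ℝ) : ℂ) := by push_cast; rfl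
        rw [this, Complex.add_re, Complex.re_ofReal_mul, Complex.one_re]
      rw [h, Complex.zero_re] at h1
      have := hpos s
      have : 0 < 1 + 4 * (1 / (2 * σ ^ 2)) * (A s).re := by positivity
      linarith
    have := hΓ i
    have := ha i
    have := hb i
    fun_prop (disch := exact hQ _)
  · refine continuous_finsetSum _ fun i _ => ?_
    have := hΓ i
    have := ha i
    have := hb i
    unfold gexp
    fun_prop
  · intro s hs x
    have hs' := Set.Ioc_subset_Icc_self hs
    refine norm_sum_le_of_le _ fun i _ => ?_
    rw [norm_mul]
    refine mul_le_mul (hG i s hs') ?_ (norm_nonneg _) ((norm_nonneg _).trans (hG i s hs'))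
    exact norm_gexp_le hmpos (hmle s hs') ((hB i s hs').trans (le_max_left _ _))
      ((hB' i s hs').trans (le_max_right _ _)) x

/-! ### Exact formula for the coarse-grained cubic term -/

/-- The factor `1 / (1 + 2ish²)` by which the free flow spreads a Gaussian of width `1 / h`. -/
def damp (h s : ℝ) : ℂ := 1 / (1 + 2 * Complex.I * s * h ^ 2)

/-- The complex inverse square width of a product `u ū u` of three evolved packets. -/
def tripleWidth (h s : ℝ) : ℂ := h ^ 2 / 2 * (2 * damp h s + damp h (-s))

/-- The ratio between the widths of the full product and of the test packet. -/
def smear (h σ s : ℝ) : ℂ := 1 + 4 * (1 / (2 * σ ^ 2) - Complex.I * s) * tripleWidth h s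

/-- The contribution of one coordinate to the exponent of the interaction of four packets. -/
def exponent (h σ s k₁ k₂ k₃ k : ℝ) : ℂ :=
  -Complex.I * s * (k₁ ^ 2 - k₂ ^ 2 + k₃ ^ 2 - k ^ 2)
    + 2 * Complex.I * s * (k₁ - k₂ + k₃ - k) * k
    + (1 / (2 * σ ^ 2) - Complex.I * s) * (Complex.I * (k₁ - k₂ + k₃ - k)
        + 2 * s * h ^ 2 * (damp h s * (k₁ - k) + damp h (-s) * (k₂ - k)
          + damp h s * (k₃ - k))) ^ 2 / smear h σ s
    - 2 * s ^ 2 * h ^ 2 * (damp h s * (k₁ - k) ^ 2 + damp h (-s) * (k₂ - k) ^ 2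
        + damp h s * (k₃ - k) ^ 2)

/-- The interaction at time `s` of the packets at `p.1`, `p.2.1`, `p.2.2` with the one at `K`. -/
def packet (h σ : ℝ) (K : Plane) (p : Plane × Plane × Plane) (s : ℝ) : ℂ :=
  damp h s ^ 2 * damp h (-s) / smear h σ s *
    Complex.exp (exponent h σ s (p.1 0) (p.2.1 0) (p.2.2 0) (K 0) +
      exponent h σ s (p.1 1) (p.2.1 1) (p.2.2 1) (K 1))

lemma damp_denom_ne (h s : ℝ) : 1 + 2 * Complex.I * s * h ^ 2 ≠ 0 := by
  intro hz
  have := congrArg Complex.re hz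
  simp [← Complex.ofReal_pow] at this

lemma conj_damp (h s : ℝ) : (starRingEnd ℂ) (damp h s) = damp h (-s) := by
  simp [damp, Complex.conj_ofNat]

lemma continuous_damp (h : ℝ) : Continuous (damp h) := by
  unfold damp
  exact continuous_const.div (by fun_prop) (damp_denom_ne h)

lemma damp_re (h s : ℝ) : (damp h s).re = 1 / (1 + 4 * s ^ 2 * h ^ 4) := by
  have hn : Complex.normSq (1 + 2 * Complex.I * s * h ^ 2) = 1 + 4 * s ^ 2 * h ^ 4 := by
    rw [Complex.normSq_apply]; simp [← Complex.ofReal_pow]; ring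
  rw [damp, one_div, Complex.inv_re, hn]
  simp [← Complex.ofReal_pow]

lemma damp_re_pos (h s : ℝ) : 0 < (damp h s).re := by
  rw [damp_re]; positivity

lemma tripleWidth_re_pos {h : ℝ} (hh : 0 < h) (s : ℝ) : 0 < (tripleWidth h s).re := by
  have h1 := damp_re_pos h s
  have h2 := damp_re_pos h (-s)
  have : tripleWidth h s = ((h ^ 2 / 2 : ℝ) : ℂ) * (2 * damp h s + damp h (-s)) := by
    rw [tripleWidth]; push_cast; rfl
  rw [this, Complex.re_ofReal_mul]
  have : (2 * damp h s + damp h (-s)).re = 2 * (damp h s).re + (damp h (-s)).re := by simp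
  rw [this]
  positivity

lemma continuous_tripleWidth (h : ℝ) : Continuous (tripleWidth h) := by
  have := continuous_damp h
  unfold tripleWidth
  fun_prop

/-- A zero would force 1/(4 `tripleWidth`) to have real part -1/(2σ²), whereas that real part is
positive. -/
lemma smear_ne_zero {h σ : ℝ} (hh : 0 < h) (hσ : 0 < σ) (s : ℝ) : smear h σ s ≠ 0 := by
  intro hz
  have h1 := re_one_div_four_mul (tripleWidth_re_pos hh s)
  have h0 : tripleWidth h s ≠ 0 := fun h' => by
    have := tripleWidth_re_pos hh s
    simp [h'] at this
  have h2 : 1 / (4 * tripleWidth h s) = -((1 / (2 * σ ^ 2) : ℝ) : ℂ) + Complex.I * s := by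
    rw [smear] at hz
    push_cast
    rw [div_eq_iff (by simpa using h0)]
    linear_combination hz
  rw [h2, Complex.add_re, Complex.neg_re, Complex.ofReal_re] at h1
  have : (0 : ℝ) < 1 / (2 * σ ^ 2) := by positivity
  have hI : (Complex.I * (s : ℂ)).re = 0 := by simp
  linarith

lemma continuous_smear (h σ : ℝ) : Continuous (smear h σ) := by
  have := continuous_tripleWidth h
  unfold smear
  fun_prop

lemma gauss_eq (K : Plane) (h : ℝ) (x : Plane) :
    gauss K h x = (1 / (2 * (Real.pi : ℂ)) ^ 2) *
      gexp (h ^ 2 / 2) (Complex.I * K 0) (Complex.I * K 1) x := by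
  rw [gauss, mul_assoc, Complex.ofReal_exp, ← Complex.exp_add, gexp, norm_sq_eq, inner_eq]
  congr 2
  push_cast
  ring

lemma initialDatum_eq {η : Plane → ℂ} {L : ℝ} {S : Finset Plane}
    (hS : ∀ K ∈ S, K ∈ lattice L) (hη : ∀ K ∈ lattice L, K ∉ S → η K = 0) (h : ℝ) :
    initialDatum η h L = fun x => ∑ K ∈ S, (η K * (1 / (2 * (Real.pi : ℂ)) ^ 2)) *
      gexp (h ^ 2 / 2) (Complex.I * K 0) (Complex.I * K 1) x := by
  funext x
  rw [initialDatum, tsum_subtype (lattice L) (fun K => η K * gauss K h x),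
    tsum_eq_sum (s := S)]
  · refine Finset.sum_congr rfl fun K hK => ?_
    rw [Set.indicator_of_mem (hS K hK), gauss_eq, mul_assoc]
  · intro K hK
    by_cases hL : K ∈ lattice L
    · rw [Set.indicator_of_mem hL, hη K hL hK, zero_mul]
    · rw [Set.indicator_of_notMem hL]

lemma norm_sq_mul_eq (z : ℂ) : ((‖z‖ ^ 2 : ℝ) : ℂ) * z = z * (starRingEnd ℂ) z * z := by
  rw [Complex.mul_conj, Complex.normSq_eq_norm_sq]

/-- The amplitude of a product of three evolved packets. -/
def cubicAmp (h : ℝ) (p : Plane × Plane × Plane) (s : ℝ) : ℂ :=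
  (1 / (2 * (Real.pi : ℂ)) ^ 2) ^ 3 * (damp h s ^ 2 * damp h (-s)) *
    Complex.exp (-Complex.I * s * damp h s * ((p.1 0) ^ 2 + (p.1 1) ^ 2)
      + Complex.I * s * damp h (-s) * ((p.2.1 0) ^ 2 + (p.2.1 1) ^ 2)
      - Complex.I * s * damp h s * ((p.2.2 0) ^ 2 + (p.2.2 1) ^ 2))

/-- The linear coefficients of a product of three evolved packets. -/
def cubicLin (h : ℝ) (p : Plane × Plane × Plane) (j : Fin 2) (s : ℝ) : ℂ :=
  Complex.I * (damp h s * p.1 j - damp h (-s) * p.2.1 j + damp h s * p.2.2 j)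

lemma propagator_datum {h : ℝ} (hh : 0 < h) (η : Plane → ℂ) (S : Finset Plane) (s : ℝ) :
    propagator s (fun x => ∑ K ∈ S, (η K * (1 / (2 * (Real.pi : ℂ)) ^ 2)) *
      gexp (h ^ 2 / 2) (Complex.I * K 0) (Complex.I * K 1) x) = fun x =>
      ∑ K ∈ S, (η K * (1 / (2 * (Real.pi : ℂ)) ^ 2 * damp h s *
        Complex.exp (-Complex.I * s * damp h s * ((K 0) ^ 2 + (K 1) ^ 2)))) *
      gexp (h ^ 2 / 2 * damp h s) (Complex.I * damp h s * K 0) (Complex.I * damp h s * K 1) x := by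
  have hre : 0 < ((h : ℂ) ^ 2 / 2).re := by
    have : ((h : ℂ) ^ 2 / 2) = ((h ^ 2 / 2 : ℝ) : ℂ) := by push_cast; rfl
    rw [this, Complex.ofReal_re]; positivity
  rw [propagator_sum_gexp S _ hre]
  have hq : 1 + 4 * Complex.I * s * ((h : ℂ) ^ 2 / 2) = 1 + 2 * Complex.I * s * h ^ 2 := by ring
  funext x
  refine Finset.sum_congr rfl fun K _ => ?_
  rw [hq]
  have h1 : ∀ z : ℂ, z / (1 + 2 * Complex.I * s * h ^ 2) = z * damp h s := by
    intro z; rw [damp]; ring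
  simp_rw [h1]
  have e1 : Complex.I * s * ((Complex.I * K 0) ^ 2 + (Complex.I * K 1) ^ 2) * damp h s =
      -Complex.I * s * damp h s * ((K 0) ^ 2 + (K 1) ^ 2) := by
    linear_combination (Complex.I * s * ((K 0) ^ 2 + (K 1) ^ 2) * damp h s) * Complex.I_sq
  rw [e1, mul_right_comm _ _ (damp h s), mul_right_comm _ _ (damp h s)]
  ring_nf

lemma cubic_datum (h : ℝ) (η : Plane → ℂ) (S : Finset Plane) (s : ℝ) (y : Plane)
    {u : Plane → ℂ} (hu : u = fun x =>
      ∑ K ∈ S, (η K * (1 / (2 * (Real.pi : ℂ)) ^ 2 * damp h s *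
        Complex.exp (-Complex.I * s * damp h s * ((K 0) ^ 2 + (K 1) ^ 2)))) *
      gexp (h ^ 2 / 2 * damp h s) (Complex.I * damp h s * K 0)
        (Complex.I * damp h s * K 1) x) :
    ((‖u y‖ ^ 2 : ℝ) : ℂ) * u y = ∑ p ∈ S ×ˢ S ×ˢ S,
      (η p.1 * (starRingEnd ℂ) (η p.2.1) * η p.2.2 * cubicAmp h p s) *
        gexp (tripleWidth h s) (cubicLin h p 0 s) (cubicLin h p 1 s) y := by
  rw [norm_sq_mul_eq, mul_assoc, hu]
  simp only []
  rw [map_sum, Finset.sum_mul_sum, ← Finset.sum_product', Finset.sum_mul_sum,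
    ← Finset.sum_product']
  refine Finset.sum_congr rfl fun p _ => ?_
  rw [map_mul, conj_gexp]
  have hA : tripleWidth h s = h ^ 2 / 2 * damp h s + (h ^ 2 / 2 * damp h (-s) +
      h ^ 2 / 2 * damp h s) := by rw [tripleWidth]; ring
  have hl : ∀ j, cubicLin h p j s = Complex.I * damp h s * p.1 j +
      (-Complex.I * damp h (-s) * p.2.1 j + Complex.I * damp h s * p.2.2 j) := by
    intro j; rw [cubicLin]; ring
  rw [hA, hl, hl, ← gexp_mul, ← gexp_mul, cubicAmp, sub_eq_add_neg, Complex.exp_add,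
    Complex.exp_add]
  simp only [map_mul, map_div₀, map_pow, map_one, map_neg, map_add, Complex.conj_ofReal,
    Complex.conj_I, conj_damp, ← Complex.exp_conj, Complex.conj_ofNat, neg_neg]
  have : -(Complex.I * s * damp h s * ((p.2.2 0 : ℂ) ^ 2 + (p.2.2 1 : ℂ) ^ 2)) =
    -Complex.I * s * damp h s * ((p.2.2 0) ^ 2 + (p.2.2 1) ^ 2) := by ring
  rw [this]
  ring

/-- The left side is what the Gaussian integrals produce; the right side is the form fit for
estimates. From (1 + 2ish²) `damp` = 1 one gets is·`damp` = is + 2s²h²·`damp`, which separates the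
oscillating phase from the damping. Recentring the frequencies at `k` leaves, apart from purely
imaginary terms, only the differences `kᵢ - k`. -/
lemma exponent_eq {h σ s k₁ k₂ k₃ k : ℝ} {c A ρ : ℂ}
    (hA : A = tripleWidth h s) (hρ : ρ = 1 - 4 * Complex.I * s * A) (hρ0 : ρ ≠ 0)
    (hQ : smear h σ s ≠ 0)
    (hc : c = Complex.I * (damp h s * k₁ - damp h (-s) * k₂ + damp h s * k₃)) :
    -Complex.I * s * damp h s * k₁ ^ 2 + Complex.I * s * damp h (-s) * k₂ ^ 2
      - Complex.I * s * damp h s * k₃ ^ 2 + -Complex.I * s * c ^ 2 / ρ +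
      1 / (2 * σ ^ 2) * (c / ρ - Complex.I * k) ^ 2 * ρ / smear h σ s =
    exponent h σ s k₁ k₂ k₃ k := by
  have hu : damp h s * (1 + 2 * Complex.I * s * h ^ 2) = 1 := by
    rw [damp, one_div, inv_mul_cancel₀ (damp_denom_ne _ _)]
  have hv : damp h (-s) * (1 - 2 * Complex.I * s * h ^ 2) = 1 := by
    have := damp_denom_ne h (-s)
    rw [Complex.ofReal_neg] at this
    rw [damp, one_div]
    have e : 1 - 2 * Complex.I * s * (h : ℂ) ^ 2 = 1 + 2 * Complex.I * ((-s : ℝ) : ℂ) * h ^ 2 := by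
      push_cast; ring
    rw [e, inv_mul_cancel₀ (by exact_mod_cast this)]
  have hS : smear h σ s = ρ + 4 * (1 / (2 * σ ^ 2)) * A := by rw [smear, hρ, hA]; ring
  have hS' : smear h σ s = 1 + 4 * (1 / (2 * σ ^ 2) - Complex.I * s) * A := by rw [smear, hA]
  rw [exponent]
  rw [tripleWidth] at hA
  generalize damp h s = u at *
  generalize damp h (-s) = v at *
  generalize smear h σ s = Q at *
  generalize (1 / (2 * (σ : ℂ) ^ 2)) = β₀ at *
  have step1 : -Complex.I * s * c ^ 2 / ρ + β₀ * (c / ρ - Complex.I * k) ^ 2 * ρ / Q =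
      ((β₀ - Complex.I * s) * (c - Complex.I * k) ^ 2 + 2 * s * k * (c - Complex.I * k)
        - 4 * A * s ^ 2 * k ^ 2) / Q + Complex.I * s * k ^ 2 := by
    field_simp
    rw [hS, hρ]
    ring_nf
    simp only [Complex.I_sq, Complex.I_pow_three, Complex.I_pow_four]
    ring
  have hI := Complex.I_sq
  have hu' : Complex.I * s * u = Complex.I * s + 2 * s ^ 2 * h ^ 2 * u := by
    linear_combination (Complex.I * s) * hu - 2 * s ^ 2 * h ^ 2 * u * hI
  have hv' : Complex.I * s * v = Complex.I * s - 2 * s ^ 2 * h ^ 2 * v := by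
    linear_combination (Complex.I * s) * hv + 2 * s ^ 2 * h ^ 2 * v * hI
  have hw : c - Complex.I * k = (Complex.I * (k₁ - k₂ + k₃ - k)
        + 2 * s * h ^ 2 * (u * (k₁ - k) + v * (k₂ - k) + u * (k₃ - k))) + 4 * s * A * k := by
    rw [hc, hA]
    linear_combination Complex.I * (k₁ + k₃) * hu - Complex.I * k₂ * hv
      - 2 * s * h ^ 2 * (u * k₁ + v * k₂ + u * k₃) * hI
  set w := (Complex.I * (k₁ - k₂ + k₃ - k)
        + 2 * s * h ^ 2 * (u * (k₁ - k) + v * (k₂ - k) + u * (k₃ - k))) with hwd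
  -- Since Q = 1 + 4(β₀ - is)A, the shift 4sAk in c - ik produces exactly the factors of Q that
  -- cancel the denominator in the terms linear and quadratic in k.
  have step2 : ((β₀ - Complex.I * s) * (c - Complex.I * k) ^ 2 + 2 * s * k * (c - Complex.I * k)
        - 4 * A * s ^ 2 * k ^ 2) / Q = (β₀ - Complex.I * s) * w ^ 2 / Q + 2 * s * k * w
          + 4 * A * s ^ 2 * k ^ 2 := by
    rw [hw]
    field_simp
    rw [hS']
    ring
  rw [add_assoc, step1, step2, hwd, hA]
  linear_combination (-k₁ ^ 2 - k₃ ^ 2 : ℂ) * hu' + (k₂ : ℂ) ^ 2 * hv'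

lemma continuous_cubicAmp (h : ℝ) (p : Plane × Plane × Plane) : Continuous (cubicAmp h p) := by
  have h1 := continuous_damp h
  unfold cubicAmp
  fun_prop

lemma continuous_cubicLin (h : ℝ) (p : Plane × Plane × Plane) (j : Fin 2) :
    Continuous (cubicLin h p j) := by
  have h1 := continuous_damp h
  unfold cubicLin
  fun_prop

lemma tripleDenom_ne {h : ℝ} (hh : 0 < h) (s : ℝ) :
    1 + 4 * Complex.I * ((-s : ℝ) : ℂ) * tripleWidth h s ≠ 0 :=
  one_add_ne_zero (tripleWidth_re_pos hh s) (-s)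

/-- Three initial packets contribute (2π)⁻⁶ and the coarse-graining integral contributes 4π², whence
the prefactor (2π)⁻⁴. The finite set `S` only has to contain the lattice points where `η` is
nonzero. -/
lemma coarse_firstOrder {η : Plane → ℂ} {L : ℝ} {S : Finset Plane}
    (hS : ∀ K ∈ S, K ∈ lattice L) (hη : ∀ K ∈ lattice L, K ∉ S → η K = 0) {h σ t : ℝ}
    (hh : 0 < h) (hσ : 0 < σ) (ht : 0 ≤ t) (K : Plane) :
    coarse (firstOrder (initialDatum η h L) t) K σ = (1 / (2 * (Real.pi : ℂ)) ^ 4) *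
      ∑ p ∈ S ×ˢ S ×ˢ S, η p.1 * (starRingEnd ℂ) (η p.2.1) * η p.2.2 *
        ∫ s in (0 : ℝ)..t, packet h σ K p s := by
  have hpi : (Real.pi : ℂ) ≠ 0 := by exact_mod_cast Real.pi_ne_zero
  set ρ : ℝ → ℂ := fun s => 1 + 4 * Complex.I * ((-s : ℝ) : ℂ) * tripleWidth h s with hρ
  have hρ0 : ∀ s, ρ s ≠ 0 := tripleDenom_ne hh
  have hρc : Continuous ρ := by
    have := continuous_tripleWidth h
    rw [hρ]; fun_prop
  have hF : firstOrder (initialDatum η h L) t = fun x => ∫ s in (0 : ℝ)..t,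
      ∑ p ∈ S ×ˢ S ×ˢ S, (η p.1 * (starRingEnd ℂ) (η p.2.1) * η p.2.2 * cubicAmp h p s *
        (1 / ρ s * Complex.exp (Complex.I * ((-s : ℝ) : ℂ) *
          (cubicLin h p 0 s ^ 2 + cubicLin h p 1 s ^ 2) / ρ s))) *
        gexp (tripleWidth h s / ρ s) (cubicLin h p 0 s / ρ s) (cubicLin h p 1 s / ρ s) x := by
    funext x
    rw [firstOrder]
    congr 1
    funext s
    have h1 : (fun y => ((‖propagator s (initialDatum η h L) y‖ ^ 2 : ℝ) : ℂ) *
        propagator s (initialDatum η h L) y) = fun y => ∑ p ∈ S ×ˢ S ×ˢ S,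
      (η p.1 * (starRingEnd ℂ) (η p.2.1) * η p.2.2 * cubicAmp h p s) *
        gexp (tripleWidth h s) (cubicLin h p 0 s) (cubicLin h p 1 s) y := by
      funext y
      refine cubic_datum h η S s y ?_
      rw [initialDatum_eq hS hη, propagator_datum hh]
    rw [h1, propagator_sum_gexp _ _ (tripleWidth_re_pos hh s)]
  have hl := continuous_cubicLin h
  have hamp := continuous_cubicAmp h
  rw [hF, coarse_integral_gexp
    (Γ := fun p s => η p.1 * (starRingEnd ℂ) (η p.2.1) * η p.2.2 * cubicAmp h p s *
        (1 / ρ s * Complex.exp (Complex.I * ((-s : ℝ) : ℂ) *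
          (cubicLin h p 0 s ^ 2 + cubicLin h p 1 s ^ 2) / ρ s)))
    (A := fun s => tripleWidth h s / ρ s) (a := fun p s => cubicLin h p 0 s / ρ s)
    (b := fun p s => cubicLin h p 1 s / ρ s)]
  · rw [Finset.mul_sum]
    refine Finset.sum_congr rfl fun p _ => ?_
    rw [← mul_assoc, ← intervalIntegral.integral_const_mul]
    congr 1
    funext s
    have hQ := smear_ne_zero hh hσ s
    have hρs := hρ0 s
    have hρe : ρ s = 1 - 4 * Complex.I * s * tripleWidth h s := by
      rw [hρ]; push_cast; ring
    have hS : smear h σ s = ρ s + 4 * (1 / (2 * σ ^ 2)) * tripleWidth h s := by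
      rw [smear, hρe]; ring
    have e0 := exponent_eq (k₁ := p.1 0) (k₂ := p.2.1 0) (k₃ := p.2.2 0) (k := K 0)
      rfl hρe hρs hQ (c := cubicLin h p 0 s) rfl
    have e1 := exponent_eq (k₁ := p.1 1) (k₂ := p.2.1 1) (k₃ := p.2.2 1) (k := K 1)
      rfl hρe hρs hQ (c := cubicLin h p 1 s) rfl
    have hden : 1 + 4 * (1 / (2 * (σ : ℂ) ^ 2)) * (tripleWidth h s / ρ s) =
        smear h σ s / ρ s := by
      rw [hS]; generalize (1 / (2 * (σ : ℂ) ^ 2)) = β; field_simp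
    rw [hden, packet, ← e0, ← e1, cubicAmp]
    generalize cubicLin h p 0 s = c at *
    generalize cubicLin h p 1 s = d at *
    generalize (1 / (2 * (σ : ℂ) ^ 2)) = β at *
    generalize smear h σ s = Q at *
    generalize ρ s = r at *
    have harg : -Complex.I * ↑s * damp h s * ↑(p.1.ofLp 0) ^ 2 +
        Complex.I * ↑s * damp h (-s) * ↑(p.2.1.ofLp 0) ^ 2 -
        Complex.I * ↑s * damp h s * ↑(p.2.2.ofLp 0) ^ 2 + -Complex.I * ↑s * c ^ 2 / r +
        β * (c / r - Complex.I * ↑(K.ofLp 0)) ^ 2 * r / Q +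
        (-Complex.I * ↑s * damp h s * ↑(p.1.ofLp 1) ^ 2 +
        Complex.I * ↑s * damp h (-s) * ↑(p.2.1.ofLp 1) ^ 2 -
        Complex.I * ↑s * damp h s * ↑(p.2.2.ofLp 1) ^ 2 + -Complex.I * ↑s * d ^ 2 / r +
        β * (d / r - Complex.I * ↑(K.ofLp 1)) ^ 2 * r / Q) =
        (-Complex.I * s * damp h s * ((p.1 0) ^ 2 + (p.1 1) ^ 2)
          + Complex.I * s * damp h (-s) * ((p.2.1 0) ^ 2 + (p.2.1 1) ^ 2)
          - Complex.I * s * damp h s * ((p.2.2 0) ^ 2 + (p.2.2 1) ^ 2)) +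
        (Complex.I * ((-s : ℝ) : ℂ) * (c ^ 2 + d ^ 2) / r) +
        (β * ((c / r - Complex.I * K 0) ^ 2 + (d / r - Complex.I * K 1) ^ 2) / (Q / r)) := by
      push_cast
      field_simp
      ring
    rw [harg, Complex.exp_add, Complex.exp_add]
    field_simp
    ring
  · intro p
    have := hamp p
    have h0 := hl p 0
    have h1 := hl p 1
    exact Continuous.mul (by fun_prop) ((continuous_const.div hρc hρ0).mul
      (Complex.continuous_exp.comp (Continuous.div (by fun_prop) hρc hρ0)))
  · exact fun p => (hl p 0).div hρc hρ0
  · exact fun p => (hl p 1).div hρc hρ0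
  · exact (continuous_tripleWidth h).div hρc hρ0
  · intro s
    exact re_div_pos (tripleWidth_re_pos hh s) (-s)
  · exact ht
  · exact hσ

open Classical in
lemma interactionSum_eq {η : Plane → ℂ} {L : ℝ} {S : Finset Plane}
    (hS : ∀ K ∈ S, K ∈ lattice L) (hη : ∀ K ∈ lattice L, K ∉ S → η K = 0) (K : Plane) (t : ℝ) :
    interactionSum η L K t = ∑ p ∈ S ×ˢ S ×ˢ S, η p.1 * (starRingEnd ℂ) (η p.2.1) * η p.2.2 *
      if K = p.1 - p.2.1 + p.2.2 then oscillation t (resonance p.1 p.2.1 p.2.2 K) else 0 := by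
  rw [interactionSum, tsum_subtype (interactions L K) (fun p : Plane × Plane × Plane =>
    η p.1 * (starRingEnd ℂ) (η p.2.1) * η p.2.2 *
      oscillation t (resonance p.1 p.2.1 p.2.2 K)), tsum_eq_sum (s := S ×ˢ S ×ˢ S)]
  · refine Finset.sum_congr rfl fun p hp => ?_
    simp only [Finset.mem_product] at hp
    by_cases h : K = p.1 - p.2.1 + p.2.2
    · rw [Set.indicator_of_mem (show p ∈ interactions L K from
        ⟨hS _ hp.1, hS _ hp.2.1, hS _ hp.2.2, h⟩), if_pos h]
    · rw [Set.indicator_of_notMem (fun h' : p ∈ interactions L K => h h'.2.2.2), if_neg h,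
        mul_zero]
  · intro p hp
    by_cases h : p ∈ interactions L K
    · rw [Set.indicator_of_mem h]
      simp only [Finset.mem_product, not_and_or] at hp
      rcases hp with hp | hp | hp
      · rw [hη _ h.1 hp]; ring
      · rw [hη _ h.2.1 hp]; simp
      · rw [hη _ h.2.2.1 hp]; ring
    · rw [Set.indicator_of_notMem h]

lemma oscillation_eq_integral (t ω : ℝ) :
    oscillation t ω = ∫ s in (0 : ℝ)..t, Complex.exp (-(Complex.I * s * ω)) := by
  rw [oscillation]
  split_ifs with h
  · simp [h]
  · have hne : (-(Complex.I * ω) : ℂ) ≠ 0 := by simp [h]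
    have := integral_exp_mul_complex (a := 0) (b := t) hne
    have e : ∀ s : ℝ, (-(Complex.I * s * ω) : ℂ) = -(Complex.I * ω) * s := by intro s; ring
    simp_rw [e]
    rw [this]
    simp only [Complex.ofReal_zero, mul_zero, Complex.exp_zero]
    rw [← neg_div_neg_eq]
    congr 1
    all_goals ring

/-! ### Size of a packet interaction -/

lemma norm_damp_le (h s : ℝ) : ‖damp h s‖ ≤ 1 := by
  rw [damp, norm_div, norm_one]
  have h1 : (1 : ℝ) ≤ ‖1 + 2 * Complex.I * (s : ℂ) * (h : ℂ) ^ 2‖ := by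
    have := Complex.abs_re_le_norm (1 + 2 * Complex.I * (s : ℂ) * (h : ℂ) ^ 2)
    have e : (1 + 2 * Complex.I * (s : ℂ) * (h : ℂ) ^ 2).re = 1 := by
      simp [← Complex.ofReal_pow]
    rwa [e, abs_one] at this
  exact div_le_one_of_le₀ h1 (norm_nonneg _)

lemma norm_damp_sub_one_le (h s : ℝ) : ‖damp h s - 1‖ ≤ 2 * |s| * h ^ 2 := by
  have e : damp h s - 1 = damp h s * (-(2 * Complex.I * s * h ^ 2)) := by
    rw [damp]
    have := damp_denom_ne h s
    field_simp
    ring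
  rw [e, norm_mul]
  calc _ ≤ 1 * ‖-(2 * Complex.I * (s : ℂ) * (h : ℂ) ^ 2)‖ :=
        mul_le_mul_of_nonneg_right (norm_damp_le h s) (norm_nonneg _)
    _ = 2 * |s| * h ^ 2 := by simp

lemma norm_tripleWidth_le (h s : ℝ) : ‖tripleWidth h s‖ ≤ 3 / 2 * h ^ 2 := by
  rw [tripleWidth, norm_mul]
  have h1 : ‖(h : ℂ) ^ 2 / 2‖ = h ^ 2 / 2 := by simp
  have h2 : ‖2 * damp h s + damp h (-s)‖ ≤ 3 := by
    refine (norm_add_le _ _).trans ?_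
    rw [norm_mul, Complex.norm_ofNat]
    linarith [norm_damp_le h s, norm_damp_le h (-s)]
  rw [h1]
  nlinarith [sq_nonneg h]

lemma norm_beta_le {σ s : ℝ} (hσ : 0 < σ) (hs : 0 ≤ s) (hsσ : s * σ ^ 2 ≤ 1) :
    ‖1 / (2 * (σ : ℂ) ^ 2) - Complex.I * s‖ ≤ 3 / 2 / σ ^ 2 := by
  refine (norm_sub_le _ _).trans ?_
  have h1 : ‖1 / (2 * (σ : ℂ) ^ 2)‖ = 1 / 2 / σ ^ 2 := by simp; ring
  have h2 : ‖Complex.I * (s : ℂ)‖ = s := by simp [abs_of_nonneg hs]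
  rw [h1, h2]
  have : s ≤ 1 / σ ^ 2 := by rw [le_div_iff₀ (by positivity)]; exact hsσ
  calc _ ≤ 1 / 2 / σ ^ 2 + 1 / σ ^ 2 := by linarith
    _ = _ := by ring

lemma ratio_sq_le {h σ : ℝ} (hh : 0 < h) (hσ : 0 < σ) (hr : 16 * h ≤ σ) :
    h ^ 2 / σ ^ 2 ≤ 1 / 256 := by
  rw [div_le_div_iff₀ (by positivity) (by norm_num)]
  nlinarith

lemma mul_sq_le_one {h σ s : ℝ} (hh : 0 < h) (hs : 0 ≤ s) (hr : 16 * h ≤ σ)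
    (hsσ : s * σ ^ 2 ≤ 1) : s * h ^ 2 ≤ 1 := by
  have : h ^ 2 ≤ σ ^ 2 := by nlinarith
  nlinarith

lemma norm_smear_sub_one_le {h σ s : ℝ} (hσ : 0 < σ) (hs : 0 ≤ s)
    (hsσ : s * σ ^ 2 ≤ 1) : ‖smear h σ s - 1‖ ≤ 9 * (h ^ 2 / σ ^ 2) := by
  have e : smear h σ s - 1 = 4 * (1 / (2 * σ ^ 2) - Complex.I * s) * tripleWidth h s := by
    rw [smear]; ring
  rw [e, norm_mul, norm_mul, Complex.norm_ofNat]
  have h1 := norm_beta_le hσ hs hsσ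
  have h2 := norm_tripleWidth_le h s
  calc _ ≤ 4 * (3 / 2 / σ ^ 2) * (3 / 2 * h ^ 2) := by gcongr
    _ = _ := by ring

/-- The condition 16h ≤ σ makes 9h²/σ² at most 9/256, so `smear` stays at distance less than 1/2
from 1. -/
lemma norm_inv_smear_le {h σ s : ℝ} (hh : 0 < h) (hσ : 0 < σ) (hs : 0 ≤ s) (hr : 16 * h ≤ σ)
    (hsσ : s * σ ^ 2 ≤ 1) : ‖(smear h σ s)⁻¹‖ ≤ 2 := by
  have h1 := norm_smear_sub_one_le (h := h) hσ hs hsσ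
  have h2 := ratio_sq_le hh hσ hr
  have h3 : (1 : ℝ) ≤ ‖smear h σ s‖ + ‖smear h σ s - 1‖ := by
    have := norm_sub_le (smear h σ s) (smear h σ s - 1)
    rwa [sub_sub_cancel, norm_one] at this
  rw [norm_inv]
  refine inv_le_of_inv_le₀ (by norm_num) ?_
  linarith

/-- With β = 1/(2σ²) - is, expand the square and use 1/`smear` = 1 - 4β·`tripleWidth`/`smear`. The
leading term -P²β has real part -P²/(2σ²), the corrections are bounded in norm, and the last group
of the exponent has nonpositive real part because Re `damp` > 0, so it is dropped. -/
lemma re_exponent_le {h σ s k₁ k₂ k₃ k D : ℝ} (hh : 0 < h) (hσ : 0 < σ) (hs : 0 ≤ s)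
    (hr : 16 * h ≤ σ) (hsσ : s * σ ^ 2 ≤ 1) (h₁ : |k₁ - k| ≤ D) (h₂ : |k₂ - k| ≤ D)
    (h₃ : |k₃ - k| ≤ D) :
    (exponent h σ s k₁ k₂ k₃ k).re ≤ -(k₁ - k₂ + k₃ - k) ^ 2 / (2 * σ ^ 2)
      + 27 * (k₁ - k₂ + k₃ - k) ^ 2 * (h ^ 2 / σ ^ 4)
      + 36 * s * (|k₁ - k₂ + k₃ - k| * D) + 108 * s * D ^ 2 := by
  set P := k₁ - k₂ + k₃ - k with hP
  have hD : 0 ≤ D := (abs_nonneg _).trans h₁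
  set β : ℂ := 1 / (2 * σ ^ 2) - Complex.I * s with hβ
  set T : ℂ := damp h s * (k₁ - k) + damp h (-s) * (k₂ - k) + damp h s * (k₃ - k) with hT
  have hβn : ‖β‖ ≤ 3 / 2 / σ ^ 2 := norm_beta_le hσ hs hsσ
  have hβre : β.re = 1 / (2 * σ ^ 2) := by
    rw [hβ]
    have : (1 / (2 * (σ : ℂ) ^ 2)) = ((1 / (2 * σ ^ 2) : ℝ) : ℂ) := by push_cast; rfl
    rw [this, Complex.sub_re, Complex.ofReal_re]; simp
  have hQ := smear_ne_zero hh hσ s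
  have hQi := norm_inv_smear_le hh hσ hs hr hsσ
  have hTn : ‖T‖ ≤ 3 * D := by
    have key : ∀ (s' x : ℝ), |x - k| ≤ D → ‖damp h s' * ((x : ℂ) - k)‖ ≤ D := by
      intro s' x hx
      rw [norm_mul, ← Complex.ofReal_sub, Complex.norm_real, Real.norm_eq_abs]
      calc _ ≤ 1 * D := mul_le_mul (norm_damp_le h s') hx (abs_nonneg _) zero_le_one
        _ = D := one_mul D
    refine (norm_add₃_le).trans ?_
    linarith [key s k₁ h₁, key (-s) k₂ h₂, key s k₃ h₃]
  set Z : ℂ := P ^ 2 * (4 * β * β * tripleWidth h s * (smear h σ s)⁻¹)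
        + β * (smear h σ s)⁻¹ * (4 * Complex.I * s * h ^ 2 * P * T
          + 4 * s ^ 2 * h ^ 4 * T ^ 2) with hZ
  have hdecomp : exponent h σ s k₁ k₂ k₃ k =
      Complex.I * ((-s * (k₁ ^ 2 - k₂ ^ 2 + k₃ ^ 2 - k ^ 2) + 2 * s * P * k : ℝ) : ℂ)
      + (((-P ^ 2 : ℝ) : ℂ) * β + Z)
      - (((2 * s ^ 2 * h ^ 2 * ((k₁ - k) ^ 2 + (k₃ - k) ^ 2) : ℝ) : ℂ) * damp h s
        + ((2 * s ^ 2 * h ^ 2 * (k₂ - k) ^ 2 : ℝ) : ℂ) * damp h (-s)) := by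
    have hQe : smear h σ s = 1 + 4 * β * tripleWidth h s := by rw [smear]
    have hPc : (k₁ - k₂ + k₃ - k : ℂ) = P := by rw [hP]; push_cast; rfl
    rw [exponent, hPc, ← hβ, ← hT]
    have : β * (Complex.I * P + 2 * s * h ^ 2 * T) ^ 2 / smear h σ s =
        ((-P ^ 2 : ℝ) : ℂ) * β + Z := by
      rw [hZ]
      clear_value β T
      field_simp
      push_cast
      rw [hQe]
      linear_combination β * (P : ℂ) ^ 2 * Complex.I_sq
    rw [this]
    push_cast
    ring
  have hmain : ‖Z‖ ≤ 27 * P ^ 2 * (h ^ 2 / σ ^ 4)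
      + 36 * s * (|P| * D) + 108 * s * D ^ 2 := by
    refine (norm_add_le _ _).trans ?_
    have hW := norm_tripleWidth_le h s
    have a1 : ‖(P : ℂ) ^ 2 * (4 * β * β * tripleWidth h s * (smear h σ s)⁻¹)‖ ≤
        27 * P ^ 2 * (h ^ 2 / σ ^ 4) := by
      simp only [norm_mul, norm_pow, Complex.norm_real, Complex.norm_ofNat, Real.norm_eq_abs,
        sq_abs]
      calc _ ≤ P ^ 2 * (4 * (3 / 2 / σ ^ 2) * (3 / 2 / σ ^ 2) * (3 / 2 * h ^ 2) * 2) := by gcongr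
        _ = _ := by field_simp; norm_num
    have a2 : ‖β * (smear h σ s)⁻¹ * (4 * Complex.I * s * h ^ 2 * P * T
          + 4 * s ^ 2 * h ^ 4 * T ^ 2)‖ ≤ 36 * s * (|P| * D) + 108 * s * D ^ 2 := by
      have b1 : ‖4 * Complex.I * (s : ℂ) * (h : ℂ) ^ 2 * P * T + 4 * (s : ℂ) ^ 2 * (h : ℂ) ^ 4
          * T ^ 2‖ ≤ 4 * s * h ^ 2 * |P| * (3 * D) + 4 * s ^ 2 * h ^ 4 * (3 * D) ^ 2 := by
        refine (norm_add_le _ _).trans ?_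
        simp only [norm_mul, norm_pow, Complex.norm_real, Complex.norm_ofNat, Real.norm_eq_abs,
          Complex.norm_I, abs_of_nonneg hs, abs_of_pos hh, mul_one]
        gcongr
      have hrat := ratio_sq_le hh hσ hr
      rw [norm_mul, norm_mul]
      calc _ ≤ (3 / 2 / σ ^ 2) * 2 *
            (4 * s * h ^ 2 * |P| * (3 * D) + 4 * s ^ 2 * h ^ 4 * (3 * D) ^ 2) := by gcongr
        _ = 36 * s * (|P| * D) * (h ^ 2 / σ ^ 2)
            + 108 * s * D ^ 2 * ((s * σ ^ 2) * (h ^ 2 / σ ^ 2) ^ 2) := by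
          field_simp; ring
        _ ≤ 36 * s * (|P| * D) * 1 + 108 * s * D ^ 2 * (1 * 1 ^ 2) := by
          gcongr <;> linarith
        _ = _ := by ring
    linarith
  have hre := (Complex.re_le_norm _).trans hmain
  clear_value Z
  rw [hdecomp, Complex.sub_re, Complex.add_re, Complex.add_re, Complex.re_ofReal_mul,
    Complex.add_re, Complex.re_ofReal_mul, Complex.re_ofReal_mul, hβre]
  have hI : ∀ x : ℝ, (Complex.I * (x : ℂ)).re = 0 := by intro x; simp
  rw [hI]
  have p1 : 0 ≤ 2 * s ^ 2 * h ^ 2 * ((k₁ - k) ^ 2 + (k₃ - k) ^ 2) * (damp h s).re := by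
    have := damp_re_pos h s
    positivity
  have p2 : 0 ≤ 2 * s ^ 2 * h ^ 2 * (k₂ - k) ^ 2 * (damp h (-s)).re := by
    have := damp_re_pos h (-s)
    positivity
  have e : -P ^ 2 * (1 / (2 * σ ^ 2)) = -P ^ 2 / (2 * σ ^ 2) := by ring
  rw [e]
  linarith

lemma norm_damp_div_smear_le {h σ s : ℝ} (hh : 0 < h) (hσ : 0 < σ) (hs : 0 ≤ s)
    (hr : 16 * h ≤ σ) (hsσ : s * σ ^ 2 ≤ 1) :
    ‖damp h s ^ 2 * damp h (-s) / smear h σ s‖ ≤ 2 := by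
  rw [div_eq_mul_inv, norm_mul, norm_mul, norm_pow]
  have h1 := norm_damp_le h s
  have h2 := norm_damp_le h (-s)
  have h3 := norm_inv_smear_le hh hσ hs hr hsσ
  calc ‖damp h s‖ ^ 2 * ‖damp h (-s)‖ * ‖(smear h σ s)⁻¹‖ ≤ 1 ^ 2 * 1 * 2 := by gcongr
    _ = 2 := by norm_num

lemma abs_coord_le (x : Plane) (j : Fin 2) : |x j| ≤ ‖x‖ := by
  simpa using PiLp.norm_apply_le x j

lemma norm_packet_le {h σ s D : ℝ} {K : Plane} {p : Plane × Plane × Plane} (hh : 0 < h)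
    (hσ : 0 < σ) (hs : 0 ≤ s) (hr : 16 * h ≤ σ) (hsσ : s * σ ^ 2 ≤ 1)
    (h₁ : ‖p.1 - K‖ ≤ D) (h₂ : ‖p.2.1 - K‖ ≤ D) (h₃ : ‖p.2.2 - K‖ ≤ D) :
    ‖packet h σ K p s‖ ≤ 2 * Real.exp (-‖p.1 - p.2.1 + p.2.2 - K‖ ^ 2 / (2 * σ ^ 2)
      + 27 * ‖p.1 - p.2.1 + p.2.2 - K‖ ^ 2 * (h ^ 2 / σ ^ 4)
      + 72 * s * (‖p.1 - p.2.1 + p.2.2 - K‖ * D) + 216 * s * D ^ 2) := by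
  have hD : 0 ≤ D := (norm_nonneg _).trans h₁
  rw [packet, norm_mul, Complex.norm_exp]
  refine mul_le_mul (norm_damp_div_smear_le hh hσ hs hr hsσ) (Real.exp_le_exp.2 ?_)
    (Real.exp_pos _).le zero_le_two
  have key : ∀ j, (exponent h σ s (p.1 j) (p.2.1 j) (p.2.2 j) (K j)).re ≤
      -(p.1 j - p.2.1 j + p.2.2 j - K j) ^ 2 / (2 * σ ^ 2)
      + 27 * (p.1 j - p.2.1 j + p.2.2 j - K j) ^ 2 * (h ^ 2 / σ ^ 4)
      + 36 * s * (|p.1 j - p.2.1 j + p.2.2 j - K j| * D) + 108 * s * D ^ 2 :=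
    fun j => re_exponent_le hh hσ hs hr hsσ ((abs_coord_le (p.1 - K) j).trans h₁)
    ((abs_coord_le (p.2.1 - K) j).trans h₂) ((abs_coord_le (p.2.2 - K) j).trans h₃)
  set P := p.1 - p.2.1 + p.2.2 - K with hP
  have hc : ∀ j, p.1 j - p.2.1 j + p.2.2 j - K j = P j := by intro j; simp [hP]
  have k0 := key 0
  have k1 := key 1
  simp only [hc] at k0 k1
  have m : ∀ j, s * (|P j| * D) ≤ s * (‖P‖ * D) := by
    intro j
    have := abs_coord_le P j
    gcongr
  have e1 : -‖P‖ ^ 2 / (2 * σ ^ 2) = -P 0 ^ 2 / (2 * σ ^ 2) + -P 1 ^ 2 / (2 * σ ^ 2) := by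
    rw [norm_sq_eq]; ring
  have e2 : 27 * ‖P‖ ^ 2 * (h ^ 2 / σ ^ 4) = 27 * P 0 ^ 2 * (h ^ 2 / σ ^ 4) +
    27 * P 1 ^ 2 * (h ^ 2 / σ ^ 4) := by
    rw [norm_sq_eq]; ring
  rw [Complex.add_re, e1, e2]
  linarith [m 0, m 1]

/-! ### Resonant interactions: the deviation from the limit and integration by parts -/

/-- `f` is differentiable at `s`, with `‖f s‖ ≤ M` and `‖f' s‖ ≤ M'`. -/
def C1Bound (f : ℝ → ℂ) (s M M' : ℝ) : Prop :=
  ‖f s‖ ≤ M ∧ ∃ f' : ℂ, HasDerivAt f f' s ∧ ‖f'‖ ≤ M'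

namespace C1Bound

variable {f g : ℝ → ℂ} {s M M' N N' : ℝ}

lemma mono (hf : C1Bound f s M M') (h : M ≤ N) (h' : M' ≤ N') : C1Bound f s N N' :=
  ⟨hf.1.trans h, hf.2.imp fun _ hd => ⟨hd.1, hd.2.trans h'⟩⟩

lemma add (hf : C1Bound f s M M') (hg : C1Bound g s N N') :
    C1Bound (fun r => f r + g r) s (M + N) (M' + N') := by
  obtain ⟨h1, f', hd, h2⟩ := hf
  obtain ⟨k1, g', kd, k2⟩ := hg
  exact ⟨norm_add_le_of_le h1 k1, f' + g', hd.add kd, norm_add_le_of_le h2 k2⟩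

lemma sub (hf : C1Bound f s M M') (hg : C1Bound g s N N') :
    C1Bound (fun r => f r - g r) s (M + N) (M' + N') := by
  obtain ⟨h1, f', hd, h2⟩ := hf
  obtain ⟨k1, g', kd, k2⟩ := hg
  exact ⟨norm_sub_le_of_le h1 k1, f' - g', hd.sub kd, norm_sub_le_of_le h2 k2⟩

lemma mul (hf : C1Bound f s M M') (hg : C1Bound g s N N') :
    C1Bound (fun r => f r * g r) s (M * N) (M' * N + M * N') := by
  obtain ⟨h1, f', hd, h2⟩ := hf
  obtain ⟨k1, g', kd, k2⟩ := hg
  have hM := (norm_nonneg _).trans h1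
  have hM' := (norm_nonneg _).trans h2
  refine ⟨norm_mul_le_of_le h1 k1, _, hd.mul kd, norm_add_le_of_le ?_ ?_⟩
  · exact norm_mul_le_of_le h2 k1
  · exact norm_mul_le_of_le h1 k2

lemma const_mul (c : ℂ) (hf : C1Bound f s M M') :
    C1Bound (fun r => c * f r) s (‖c‖ * M) (‖c‖ * M') := by
  obtain ⟨h1, f', hd, h2⟩ := hf
  refine ⟨norm_mul_le_of_le le_rfl h1, _, hd.const_mul c, norm_mul_le_of_le le_rfl h2⟩

lemma inv (hf : C1Bound f s M M') (h0 : f s ≠ 0) (hi : ‖(f s)⁻¹‖ ≤ N) :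
    C1Bound (fun r => (f r)⁻¹) s N (N ^ 2 * M') := by
  obtain ⟨h1, f', hd, h2⟩ := hf
  refine ⟨hi, _, hd.inv h0, ?_⟩
  have e : -f' / f s ^ 2 = ((f s)⁻¹) ^ 2 * (-f') := by field_simp
  rw [e, norm_mul, norm_pow, norm_neg]
  gcongr

lemma cexp (hf : C1Bound f s M M') (hre : (f s).re ≤ 0) :
    C1Bound (fun r => Complex.exp (f r)) s 1 M' := by
  obtain ⟨h1, f', hd, h2⟩ := hf
  have he : ‖Complex.exp (f s)‖ ≤ 1 := by
    rw [Complex.norm_exp]; exact Real.exp_le_one_iff.2 hre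
  exact ⟨he, _, hd.cexp, by simpa using norm_mul_le_of_le he h2⟩

end C1Bound

/-- The nonoscillating part of the exponent of a resonant interaction; here `x` and `y` stand for
`|K₂ - K|²` and `|K₁ - K|² + |K₃ - K|²`. -/
def slowExponent (h σ x y s : ℝ) : ℂ :=
  (4 * h ^ 4 * x : ℝ) * ((s : ℂ) ^ 2 * ((1 / (2 * σ ^ 2) - Complex.I * s) * (smear h σ s)⁻¹) *
      (damp h s + damp h (-s)) ^ 2)
    - (2 * h ^ 2 : ℝ) * ((s : ℂ) ^ 2 * (y * damp h s + x * damp h (-s)))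

/-- The relative error in replacing a resonant packet interaction by its value in the limit
`h → 0`. -/
def deviation (h σ x y s : ℝ) : ℂ :=
  Complex.exp (slowExponent h σ x y s) * (damp h s ^ 2 * damp h (-s) * (smear h σ s)⁻¹) - 1

/-- When K = K₁ - K₂ + K₃ one has (K₁ - K) + (K₃ - K) = K₂ - K, so the linear combination squared in
`exponent` collapses to (`damp h s` + `damp h (-s)`)(K₂ - K). What is left beyond the phase depends
only on the squared distances to K. -/
lemma packet_resonant {h σ : ℝ} {K : Plane} {p : Plane × Plane × Plane}
    (hK : K = p.1 - p.2.1 + p.2.2) (s : ℝ) :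
    packet h σ K p s = Complex.exp (-(Complex.I * s * resonance p.1 p.2.1 p.2.2 K)) *
      (deviation h σ (‖p.2.1 - K‖ ^ 2) (‖p.1 - K‖ ^ 2 + ‖p.2.2 - K‖ ^ 2) s + 1) := by
  have hj : ∀ j, (p.1 j : ℂ) = p.2.1 j - p.2.2 j + K j := by
    intro j
    have : K j = p.1 j - p.2.1 j + p.2.2 j := by rw [hK]; simp
    rw [this]; push_cast; ring
  rw [packet, deviation, sub_add_cancel, ← mul_assoc, ← Complex.exp_add, div_eq_mul_inv, mul_comm]
  congr 2
  simp only [exponent, slowExponent, resonance, norm_sq_eq, PiLp.sub_apply]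
  push_cast
  simp only [hj]
  ring

section Bounds

variable {h σ s : ℝ}

lemma C1Bound_ofReal (hs : 0 ≤ s) : C1Bound (fun r : ℝ => (r : ℂ)) s s 1 :=
  ⟨by simp [abs_of_nonneg hs], 1, Complex.ofRealCLM.hasDerivAt, by simp⟩

lemma hasDerivAt_damp (h s : ℝ) :
    HasDerivAt (damp h) (-2 * Complex.I * h ^ 2 * damp h s ^ 2) s := by
  have h1 : HasDerivAt (fun r : ℝ => 1 + 2 * Complex.I * (r : ℂ) * (h : ℂ) ^ 2)
      (2 * Complex.I * h ^ 2) s := by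
    have := (((Complex.ofRealCLM.hasDerivAt (x := s)).const_mul (2 * Complex.I)).mul_const
      ((h : ℂ) ^ 2)).const_add (1 : ℂ)
    simpa using this
  have h2 := h1.inv (damp_denom_ne h s)
  have e : damp h = fun r : ℝ => (1 + 2 * Complex.I * (r : ℂ) * (h : ℂ) ^ 2)⁻¹ := by
    funext r; rw [damp, one_div]
  have h3 : HasDerivAt (damp h) (-(2 * Complex.I * h ^ 2) /
      (1 + 2 * Complex.I * (s : ℂ) * (h : ℂ) ^ 2) ^ 2) s := by
    rw [e]; exact h2
  refine h3.congr_deriv ?_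
  rw [damp]
  generalize 1 + 2 * Complex.I * (s : ℂ) * (h : ℂ) ^ 2 = d
  ring

lemma C1Bound_damp (h s : ℝ) : C1Bound (damp h) s 1 (2 * h ^ 2) := by
  refine ⟨norm_damp_le h s, _, hasDerivAt_damp h s, ?_⟩
  have := norm_damp_le h s
  simp only [norm_mul, norm_neg, norm_pow, Complex.norm_ofNat, Complex.norm_I,
    Complex.norm_real, Real.norm_eq_abs, sq_abs, mul_one]
  calc 2 * h ^ 2 * ‖damp h s‖ ^ 2 ≤ 2 * h ^ 2 * 1 ^ 2 := by gcongr
    _ = 2 * h ^ 2 := by ring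

lemma C1Bound_damp_neg (h s : ℝ) : C1Bound (fun r => damp h (-r)) s 1 (2 * h ^ 2) := by
  obtain ⟨-, f', hd, h2⟩ := C1Bound_damp h (-s)
  exact ⟨norm_damp_le h (-s), _, hd.scomp s (hasDerivAt_neg s), by simpa using h2⟩

lemma C1Bound_beta (hσ : 0 < σ) (hs : 0 ≤ s) (hsσ : s * σ ^ 2 ≤ 1) :
    C1Bound (fun r : ℝ => 1 / (2 * (σ : ℂ) ^ 2) - Complex.I * r) s (3 / 2 / σ ^ 2) 1 := by
  refine ⟨norm_beta_le hσ hs hsσ, -(Complex.I * 1), ?_, by simp⟩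
  exact ((Complex.ofRealCLM.hasDerivAt (x := s)).const_mul Complex.I).const_sub _

lemma C1Bound_smear_inv (hh : 0 < h) (hσ : 0 < σ) (hs : 0 ≤ s) (hr : 16 * h ≤ σ)
    (hsσ : s * σ ^ 2 ≤ 1) : C1Bound (fun r => (smear h σ r)⁻¹) s 2 (40 * h ^ 2) := by
  have hrat := ratio_sq_le hh hσ hr
  have hW : C1Bound (tripleWidth h) s (3 / 2 * h ^ 2) (3 * h ^ 4) := by
    have := (((C1Bound_damp h s).const_mul 2).add (C1Bound_damp_neg h s)).const_mul
      ((h : ℂ) ^ 2 / 2)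
    refine this.mono ?_ ?_ <;> simp <;> nlinarith [sq_nonneg h]
  have hB := ((C1Bound_beta hσ hs hsσ).const_mul 4).mul hW
  have hd : C1Bound (smear h σ) s (‖smear h σ s‖) (10 * h ^ 2) := by
    obtain ⟨-, f', hd, h2⟩ := hB
    refine ⟨le_rfl, f', hd.const_add 1, h2.trans ?_⟩
    rw [Complex.norm_ofNat]
    have : 4 * (3 / 2 / σ ^ 2) * (3 * h ^ 4) = 18 * (h ^ 2 / σ ^ 2) * h ^ 2 := by
      field_simp; ring
    rw [this]
    nlinarith [sq_nonneg h]
  exact (hd.inv (smear_ne_zero hh hσ s) (norm_inv_smear_le hh hσ hs hr hsσ)).mono le_rfl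
    (by linarith)

lemma C1Bound_slowExponent (hh : 0 < h) (hσ : 0 < σ) (hs : 0 ≤ s) (hr : 16 * h ≤ σ)
    (hsσ : s * σ ^ 2 ≤ 1) {x y : ℝ} (hx : 0 ≤ x) (hy : 0 ≤ y) :
    C1Bound (slowExponent h σ x y) s (3 * s ^ 2 * h ^ 2 * (x + y)) (12 * s * h ^ 2 * (x + y)) := by
  have hrat := ratio_sq_le hh hσ hr
  have hsh := mul_sq_le_one hh hs hr hsσ
  have hu := C1Bound_damp h s
  have hv := C1Bound_damp_neg h s
  have hs1 := C1Bound_ofReal hs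
  have hs2 : C1Bound (fun r : ℝ => (r : ℂ) ^ 2) s (s ^ 2) (2 * s) := by
    have := hs1.mul hs1
    simp_rw [← sq] at this
    exact this.mono le_rfl (by linarith)
  have hβQ : C1Bound (fun r : ℝ => (1 / (2 * (σ : ℂ) ^ 2) - Complex.I * r) * (smear h σ r)⁻¹) s
      (3 / σ ^ 2) 3 := by
    refine ((C1Bound_beta hσ hs hsσ).mul (C1Bound_smear_inv hh hσ hs hr hsσ)).mono ?_ ?_
    · exact le_of_eq (by ring)
    · have : 3 / 2 / σ ^ 2 * (40 * h ^ 2) = 60 * (h ^ 2 / σ ^ 2) := by ring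
      rw [this]; linarith
  have huv : C1Bound (fun r => (damp h r + damp h (-r)) ^ 2) s 4 (16 * h ^ 2) := by
    have := (hu.add hv).mul (hu.add hv)
    simp_rw [← sq] at this
    exact this.mono (by norm_num) (by linarith)
  have hA : C1Bound (fun r : ℝ => (r : ℂ) ^ 2 *
      ((1 / (2 * (σ : ℂ) ^ 2) - Complex.I * r) * (smear h σ r)⁻¹) *
      (damp h r + damp h (-r)) ^ 2) s (12 * s ^ 2 / σ ^ 2) (84 * s / σ ^ 2) := by
    refine ((hs2.mul hβQ).mul huv).mono ?_ ?_
    · exact le_of_eq (by ring)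
    · have e : (2 * s * (3 / σ ^ 2) + s ^ 2 * 3) * 4 + s ^ 2 * (3 / σ ^ 2) * (16 * h ^ 2) =
          s / σ ^ 2 * (24 + 12 * (s * σ ^ 2) + 48 * (s * h ^ 2)) := by
        field_simp; ring
      rw [e]
      calc _ ≤ s / σ ^ 2 * (24 + 12 * 1 + 48 * 1) := by gcongr
        _ = _ := by ring
  have hB : C1Bound (fun r : ℝ => (r : ℂ) ^ 2 * (y * damp h r + x * damp h (-r))) s
      (s ^ 2 * (x + y)) (4 * s * (x + y)) := by
    refine (hs2.mul ((hu.const_mul (y : ℂ)).add (hv.const_mul (x : ℂ)))).mono ?_ ?_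
    · simp only [Complex.norm_real, Real.norm_of_nonneg hx, Real.norm_of_nonneg hy]
      exact le_of_eq (by ring)
    · simp only [Complex.norm_real, Real.norm_of_nonneg hx, Real.norm_of_nonneg hy]
      have : 2 * s * (y * 1 + x * 1) + s ^ 2 * (y * (2 * h ^ 2) + x * (2 * h ^ 2)) =
        s * (x + y) * (2 + 2 * (s * h ^ 2)) := by ring
      rw [this]
      calc _ ≤ s * (x + y) * (2 + 2 * 1) := by gcongr
        _ = _ := by ring
  refine ((hA.const_mul ((4 * h ^ 4 * x : ℝ) : ℂ)).sub
    (hB.const_mul ((2 * h ^ 2 : ℝ) : ℂ))).mono ?_ ?_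
  · rw [Complex.norm_real, Complex.norm_real, Real.norm_of_nonneg (by positivity),
      Real.norm_of_nonneg (by positivity)]
    have e : 4 * h ^ 4 * x * (12 * s ^ 2 / σ ^ 2) = s ^ 2 * h ^ 2 * x * (48 * (h ^ 2 / σ ^ 2)) := by
      ring
    rw [e]
    calc _ ≤ s ^ 2 * h ^ 2 * x * (48 * (1 / 256)) + 2 * h ^ 2 * (s ^ 2 * (x + y)) := by gcongr
      _ ≤ _ := by
        have : 0 ≤ s ^ 2 * h ^ 2 * x := by positivity
        have : 0 ≤ s ^ 2 * h ^ 2 * y := by positivity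
        linarith
  · rw [Complex.norm_real, Complex.norm_real, Real.norm_of_nonneg (by positivity),
      Real.norm_of_nonneg (by positivity)]
    have e : 4 * h ^ 4 * x * (84 * s / σ ^ 2) = s * h ^ 2 * x * (336 * (h ^ 2 / σ ^ 2)) := by
      ring
    rw [e]
    calc _ ≤ s * h ^ 2 * x * (336 * (1 / 256)) + 2 * h ^ 2 * (4 * s * (x + y)) := by gcongr
      _ ≤ _ := by
        have : 0 ≤ s * h ^ 2 * x := by positivity
        have : 0 ≤ s * h ^ 2 * y := by positivity
        linarith

/-- The first term of the slow exponent has no sign, but it is at most (48/256)s²h²x. Since sh² ≤ 1,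
Re `damp` ≥ 1/5, so the second term contributes at most -(2/5)s²h²(x + y) and wins. Thus the
exponential has modulus at most 1, and no loss growing with t occurs. -/
lemma re_slowExponent_le (hh : 0 < h) (hσ : 0 < σ) (hs : 0 ≤ s) (hr : 16 * h ≤ σ)
    (hsσ : s * σ ^ 2 ≤ 1) {x y : ℝ} (hx : 0 ≤ x) (hy : 0 ≤ y) :
    (slowExponent h σ x y s).re ≤ 0 := by
  have hrat := ratio_sq_le hh hσ hr
  have hsh := mul_sq_le_one hh hs hr hsσ
  have hQi := norm_inv_smear_le hh hσ hs hr hsσ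
  have hβ := norm_beta_le hσ hs hsσ
  have hu := norm_damp_le h s
  have hv := norm_damp_le h (-s)
  have hsh2 : s ^ 2 * h ^ 4 ≤ 1 := by
    have : s ^ 2 * h ^ 4 = (s * h ^ 2) ^ 2 := by ring
    rw [this]; exact pow_le_one₀ (by positivity) hsh
  have hre : ∀ r, r ^ 2 = s ^ 2 → 1 / 5 ≤ (damp h r).re := by
    intro r hr
    rw [damp_re, hr]
    exact one_div_le_one_div_of_le (by positivity) (by linarith)
  have h1 := hre s rfl
  have h2 := hre (-s) (by ring)
  rw [slowExponent, Complex.sub_re, Complex.re_ofReal_mul, Complex.re_ofReal_mul]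
  have a1 : ((s : ℂ) ^ 2 * ((1 / (2 * (σ : ℂ) ^ 2) - Complex.I * s) * (smear h σ s)⁻¹) *
      (damp h s + damp h (-s)) ^ 2).re ≤ 12 * s ^ 2 / σ ^ 2 := by
    refine (Complex.re_le_norm _).trans ?_
    have hsum : ‖damp h s + damp h (-s)‖ ≤ 2 := (norm_add_le _ _).trans (by linarith)
    rw [norm_mul, norm_mul, norm_mul, norm_pow, norm_pow, Complex.norm_real,
      Real.norm_of_nonneg hs]
    calc s ^ 2 * (‖1 / (2 * (σ : ℂ) ^ 2) - Complex.I * s‖ * ‖(smear h σ s)⁻¹‖) *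
          ‖damp h s + damp h (-s)‖ ^ 2 ≤ s ^ 2 * (3 / 2 / σ ^ 2 * 2) * 2 ^ 2 := by gcongr
      _ = _ := by ring
  have a2 : s ^ 2 * ((x + y) / 5) ≤ ((s : ℂ) ^ 2 * (y * damp h s + x * damp h (-s))).re := by
    rw [← Complex.ofReal_pow, Complex.re_ofReal_mul, Complex.add_re, Complex.re_ofReal_mul,
      Complex.re_ofReal_mul]
    gcongr
    nlinarith
  have b1 := mul_le_mul_of_nonneg_left a1 (show 0 ≤ 4 * h ^ 4 * x by positivity)
  have b2 := mul_le_mul_of_nonneg_left a2 (show 0 ≤ 2 * h ^ 2 by positivity)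
  have e : 4 * h ^ 4 * x * (12 * s ^ 2 / σ ^ 2) = s ^ 2 * h ^ 2 * x * (48 * (h ^ 2 / σ ^ 2)) := by
    ring
  have b3 : s ^ 2 * h ^ 2 * x * (48 * (h ^ 2 / σ ^ 2)) ≤ s ^ 2 * h ^ 2 * x * (48 * (1 / 256)) := by
    gcongr
  have : 0 ≤ s ^ 2 * h ^ 2 * x := by positivity
  have : 0 ≤ s ^ 2 * h ^ 2 * y := by positivity
  linarith

lemma norm_exp_sub_one_le_of_re_nonpos {z : ℂ} (hz : z.re ≤ 0) : ‖Complex.exp z - 1‖ ≤ ‖z‖ := by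
  have h := (convex_halfSpace_re_le (0 : ℝ)).norm_image_sub_le_of_norm_hasDerivWithin_le
    (f := Complex.exp) (f' := Complex.exp) (C := 1) (x := 0) (y := z)
    (fun w _ => (Complex.hasDerivAt_exp w).hasDerivWithinAt)
    (fun w hw => by rw [Complex.norm_exp]; exact Real.exp_le_one_iff.2 hw)
    (by simp) hz
  simpa using h

lemma C1Bound_deviation (hh : 0 < h) (hσ : 0 < σ) (hs : 0 ≤ s) (hr : 16 * h ≤ σ)
    (hsσ : s * σ ^ 2 ≤ 1) {x y : ℝ} (hx : 0 ≤ x) (hy : 0 ≤ y) :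
    C1Bound (deviation h σ x y) s
      (6 * s ^ 2 * h ^ 2 * (x + y) + 12 * (s * h ^ 2) + 18 * (h ^ 2 / σ ^ 2))
      (24 * s * h ^ 2 * (x + y) + 60 * h ^ 2) := by
  have hz := C1Bound_slowExponent hh hσ hs hr hsσ hx hy
  have hzre := re_slowExponent_le hh hσ hs hr hsσ hx hy
  have hu := C1Bound_damp h s
  have hp : C1Bound (fun r => damp h r ^ 2 * damp h (-r) * (smear h σ r)⁻¹) s 2 (52 * h ^ 2) := by
    have := ((hu.mul hu).mul (C1Bound_damp_neg h s)).mul (C1Bound_smear_inv hh hσ hs hr hsσ)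
    simp_rw [← sq] at this
    exact this.mono (by norm_num) (by linarith)
  constructor
  · have hQi := norm_inv_smear_le hh hσ hs hr hsσ
    -- Telescoping: each factor is replaced by 1 in turn, so that every summand contains exactly one
    -- small difference.
    have e : deviation h σ x y s = (Complex.exp (slowExponent h σ x y s) - 1) *
        (damp h s ^ 2 * damp h (-s) * (smear h σ s)⁻¹) +
        ((damp h s * (damp h s * (damp h (-s) - 1) + (damp h s - 1)) + (damp h s - 1)) *
          (smear h σ s)⁻¹ - (smear h σ s - 1) * (smear h σ s)⁻¹) := by
      have := smear_ne_zero hh hσ s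
      rw [deviation]
      field_simp
      ring
    have d1 := norm_damp_sub_one_le h s
    have d2 := norm_damp_sub_one_le h (-s)
    rw [abs_neg, abs_of_nonneg hs] at d2
    rw [abs_of_nonneg hs] at d1
    have hQ1 := norm_smear_sub_one_le (h := h) hσ hs hsσ
    have hu1 := norm_damp_le h s
    have hn : 0 ≤ 2 * s * h ^ 2 := by positivity
    have i1 := norm_add_le_of_le (norm_mul_le_of_le hu1 d2) d1
    have i2 := norm_add_le_of_le (norm_mul_le_of_le hu1 i1) d1
    have i3 := norm_sub_le_of_le (norm_mul_le_of_le i2 hQi) (norm_mul_le_of_le hQ1 hQi)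
    have i4 := norm_add_le_of_le (norm_mul_le_of_le
      ((norm_exp_sub_one_le_of_re_nonpos hzre).trans hz.1) hp.1) i3
    rw [e]
    refine i4.trans (le_of_eq ?_)
    ring
  · obtain ⟨-, f', hd, h2⟩ := (hz.cexp hzre).mul hp
    refine ⟨f', hd.sub_const 1, h2.trans ?_⟩
    have : 0 ≤ h ^ 2 := sq_nonneg h
    linarith

end Bounds

/-- Integration by parts against the phase: the two endpoints cost 2M/|ω| and the derivative costs
tM'/|ω|. -/
lemma norm_integral_exp_mul_le {f : ℝ → ℂ} {t ω M M' : ℝ} (hω : ω ≠ 0) (ht : 0 ≤ t)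
    (hf : Continuous f) (hb : ∀ s ∈ Set.Icc 0 t, C1Bound f s M M') :
    ‖∫ s in (0 : ℝ)..t, Complex.exp (-(Complex.I * s * ω)) * f s‖ ≤
      (2 * M + t * M') / |ω| := by
  have hωc : (Complex.I * ω : ℂ) ≠ 0 := by simp [hω]
  set e : ℝ → ℂ := fun s => Complex.exp (-(Complex.I * s * ω)) with he
  have hec : Continuous e := by rw [he]; fun_prop
  have hen : ∀ s, ‖e s‖ = 1 := by intro s; rw [he, Complex.norm_exp]; simp
  have hed : ∀ s, HasDerivAt e (-(Complex.I * ω) * e s) s := by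
    intro s
    have h1 : HasDerivAt (fun s : ℝ => -(Complex.I * (s : ℂ) * ω)) (-(Complex.I * ω)) s := by
      have := (((Complex.ofRealCLM.hasDerivAt (x := s)).const_mul Complex.I).mul_const
        (ω : ℂ)).fun_neg
      simpa using this
    have := h1.cexp
    rwa [mul_comm] at this
  have hcm : Continuous fun s => e s * f s := hec.mul hf
  -- The derivative of `G` is (iω)⁻¹ e f', with the undifferentiated terms cancelling. The mean
  -- value inequality for `G` then replaces the integral of f', so f' need not be integrable.
  set G : ℝ → ℂ := fun r => (∫ s in (0 : ℝ)..r, e s * f s) + (Complex.I * ω)⁻¹ * (e r * f r)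
    with hG
  have hnI : ‖(Complex.I * (ω : ℂ))⁻¹‖ = 1 / |ω| := by simp
  choose! f' hf' hf'n using fun s hs => (hb s hs).2
  have hGd : ∀ s ∈ Set.Icc 0 t, HasDerivWithinAt G ((Complex.I * ω)⁻¹ * (e s * f' s))
      (Set.Icc 0 t) s := by
    intro s hs
    have h1 : HasDerivAt (fun r => ∫ s in (0 : ℝ)..r, e s * f s) (e s * f s) s :=
      intervalIntegral.integral_hasDerivAt_right (hcm.intervalIntegrable _ _)
        (hcm.stronglyMeasurableAtFilter _ _) hcm.continuousAt
    have h2 : HasDerivAt G _ s := h1.add (((hed s).mul (hf' s hs)).const_mul (Complex.I * ω : ℂ)⁻¹)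
    refine (h2.congr_deriv ?_).hasDerivWithinAt
    linear_combination (-(e s * f s)) * (inv_mul_cancel₀ hωc)
  have hmv := norm_image_sub_le_of_norm_deriv_le_segment' hGd (C := M' / |ω|) (fun s hs => by
    rw [norm_mul, norm_mul, hnI, hen, one_mul, one_div_mul_eq_div]
    exact div_le_div_of_nonneg_right (hf'n s (Set.Ico_subset_Icc_self hs)) (abs_nonneg _))
    t (Set.right_mem_Icc.2 ht)
  have hGt : ∫ s in (0 : ℝ)..t, e s * f s =
      (G t - G 0) - (Complex.I * ω)⁻¹ * (e t * f t) + (Complex.I * ω)⁻¹ * (e 0 * f 0) := by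
    rw [hG]; simp; ring
  rw [hGt]
  have hend : ∀ s ∈ Set.Icc 0 t, ‖(Complex.I * (ω : ℂ))⁻¹ * (e s * f s)‖ ≤ M / |ω| := by
    intro s hs
    rw [norm_mul, norm_mul, hnI, hen, one_mul, one_div_mul_eq_div]
    exact div_le_div_of_nonneg_right (hb s hs).1 (abs_nonneg _)
  refine (norm_add_le_of_le (norm_sub_le_of_le hmv (hend t (Set.right_mem_Icc.2 ht)))
    (hend 0 (Set.left_mem_Icc.2 ht))).trans (le_of_eq ?_)
  ring

/-! ### Counting orthogonal integer vectors -/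

/-- The integers of absolute value at most `N`. -/
def intBox (N : ℕ) : Finset ℤ := Finset.Icc (-(N : ℤ)) N

lemma mem_intBox {N : ℕ} {a : ℤ} : a ∈ intBox N ↔ |a| ≤ N := by
  rw [intBox, Finset.mem_Icc, abs_le]

lemma card_intBox (N : ℕ) : (intBox N).card = 2 * N + 1 := by
  rw [intBox, Int.card_Icc]; omega

lemma sum_inv_le (N : ℕ) : ∑ x ∈ Finset.Icc 1 N, ((x : ℝ))⁻¹ ≤ 1 + Real.log N := by
  have := harmonic_le_one_add_log N
  rw [harmonic_eq_sum_Icc] at this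
  push_cast at this
  exact this

/-- Pairs of integer vectors of sup norm at most `N` that are orthogonal. -/
def orthPairs (N : ℕ) : Finset ((ℤ × ℤ) × (ℤ × ℤ)) :=
  ((intBox N ×ˢ intBox N) ×ˢ (intBox N ×ˢ intBox N)).filter
    fun q => q.1.1 * q.2.1 + q.1.2 * q.2.2 = 0

/-- Parameters `(x, y, g, k)` of the orthogonal pairs `(g x, g y)`, `(-k y, k x)` with `|y| ≤ x`. -/
def orthParams (N : ℕ) : Finset (Σ _ : ℕ, ℤ × (ℤ × ℤ)) :=
  (Finset.Icc 1 N).sigma fun x => intBox x ×ˢ (intBox (N / x) ×ˢ intBox (N / x))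

/-- Each x contributes at most 3x·(3N/x)² = 27N²/x parameters; the harmonic sum gives the logarithm.
-/
lemma card_orthParams_le (N : ℕ) :
    ((orthParams N).card : ℝ) ≤ 27 * N ^ 2 * (1 + Real.log N) := by
  rw [orthParams, Finset.card_sigma]
  push_cast
  calc _ ≤ ∑ x ∈ Finset.Icc 1 N, 27 * (N : ℝ) ^ 2 * (x : ℝ)⁻¹ := by
        refine Finset.sum_le_sum fun x hx => ?_
        obtain ⟨h1, h2⟩ := Finset.mem_Icc.1 hx
        have hx0 : (1 : ℝ) ≤ x := by exact_mod_cast h1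
        have hxN : (x : ℝ) ≤ N := by exact_mod_cast h2
        simp only [Finset.card_product, card_intBox]
        push_cast
        have h3 : ((N / x : ℕ) : ℝ) ≤ N / x := Nat.cast_div_le
        have h4 : (1 : ℝ) ≤ N / x := by rw [le_div_iff₀ (by linarith)]; linarith
        have h5 : 2 * ((N / x : ℕ) : ℝ) + 1 ≤ 3 * (N / x) := by linarith
        have h6 : 2 * (x : ℝ) + 1 ≤ 3 * x := by linarith
        calc _ ≤ 3 * (x : ℝ) * (3 * (N / x) * (3 * (N / x))) := by gcongr
          _ = _ := by field_simp; ring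
    _ = 27 * (N : ℝ) ^ 2 * ∑ x ∈ Finset.Icc 1 N, ((x : ℝ))⁻¹ := by rw [Finset.mul_sum]
    _ ≤ _ := by gcongr; exact sum_inv_le N

/-- Divide (a, b) by its gcd to get a coprime vector (x, y); a vector orthogonal to it is an integer
multiple of (-y, x). Both multipliers are then bounded by N/|x|. Coprimality is not recorded in
`orthParams`, as only an upper bound on the count is needed. -/
lemma exists_orthParams {N : ℕ} {a b c d : ℤ} (ha : a ≠ 0) (hab : |b| ≤ |a|) (haN : |a| ≤ N)
    (hdN : |d| ≤ N) (h : a * c + b * d = 0) :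
    ∃ q ∈ orthParams N, a = q.2.2.1 * q.1 ∧ b = q.2.2.1 * q.2.1 ∧ c = -(q.2.2.2 * q.2.1) ∧
      d = q.2.2.2 * q.1 := by
  have hg : Int.gcd a b ≠ 0 := fun h0 => ha (Int.gcd_eq_zero_iff.1 h0).1
  obtain ⟨x, y, hcop, hx, hy⟩ : ∃ x y : ℤ, IsCoprime x y ∧ a = x * Int.gcd a b ∧
      b = y * Int.gcd a b := by
    obtain ⟨x, y, h1, h2, h3⟩ := Int.exists_gcd_one (m := a) (n := b) (Nat.pos_of_ne_zero hg)
    exact ⟨x, y, Int.isCoprime_iff_gcd_eq_one.2 h1, h2, h3⟩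
  set G : ℤ := (Int.gcd a b : ℤ) with hG
  have hG0 : G ≠ 0 := by rw [hG]; exact_mod_cast hg
  have hx0 : x ≠ 0 := fun h0 => ha (by rw [hx, h0, zero_mul])
  have horth : x * c + y * d = 0 := by
    have : G * (x * c + y * d) = 0 := by
      linear_combination h - c * hx - d * hy
    exact (mul_eq_zero.1 this).resolve_left hG0
  obtain ⟨k, hk⟩ : x ∣ d := by
    refine hcop.dvd_of_dvd_mul_left ⟨-c, ?_⟩
    linarith
  have hc : c = -(k * y) := by
    have : x * (c + k * y) = 0 := by rw [← horth, hk]; ring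
    have := (mul_eq_zero.1 this).resolve_left hx0
    linarith
  -- The sign of x is normalized to be positive; multiplying y and both multipliers by the same sign
  -- leaves all products unchanged.
  obtain ⟨ε, hε, hεx⟩ : ∃ ε : ℤ, ε * ε = 1 ∧ ε * x = x.natAbs := by
    rcases le_total 0 x with h0 | h0
    · exact ⟨1, by norm_num, by rw [one_mul, Int.natAbs_of_nonneg h0]⟩
    · exact ⟨-1, by norm_num, by rw [Int.ofNat_natAbs_of_nonpos h0]; ring⟩
  have hεabs : |ε| = 1 := by
    rcases mul_self_eq_one_iff.1 hε with h | h <;> simp [h]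
  have hxabs : (x.natAbs : ℤ) = |x| := Int.natCast_natAbs x
  have hxpos : 1 ≤ x.natAbs := Nat.one_le_iff_ne_zero.2 (Int.natAbs_ne_zero.2 hx0)
  have hbound : ∀ z : ℤ, |z * x| ≤ N → |ε * z| ≤ ((N / x.natAbs : ℕ) : ℤ) := by
    intro z hz
    rw [abs_mul, hεabs, one_mul]
    rw [abs_mul, ← hxabs] at hz
    push_cast
    rw [← hxabs]
    exact (Int.le_ediv_iff_mul_le (by exact_mod_cast hxpos)).2 hz
  refine ⟨⟨x.natAbs, ε * y, ε * G, ε * k⟩, ?_, ?_, ?_, ?_, ?_⟩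
  · simp only [orthParams, Finset.mem_sigma, Finset.mem_product, mem_intBox, Finset.mem_Icc]
    refine ⟨⟨hxpos, ?_⟩, ?_, ?_, ?_⟩
    · have : |x| ≤ N := by
        refine le_trans ?_ haN
        rw [hx, abs_mul]
        exact le_mul_of_one_le_right (abs_nonneg _) (Int.one_le_abs hG0)
      rw [← hxabs] at this
      exact_mod_cast this
    · rw [hxabs, abs_mul, hεabs, one_mul]
      rw [hx, hy, abs_mul, abs_mul] at hab
      exact le_of_mul_le_mul_right hab (abs_pos.2 hG0)
    · exact hbound G (by rw [mul_comm, ← hx]; exact haN)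
    · exact hbound k (by rw [mul_comm, ← hk]; exact hdN)
  · simp only []
    rw [← hεx, hx]
    linear_combination (-(G * x)) * hε
  · simp only []
    rw [hy]
    linear_combination (-(G * y)) * hε
  · simp only []
    rw [hc]
    linear_combination (k * y) * hε
  · simp only []
    rw [← hεx, hk]
    linear_combination (-(k * x)) * hε

/-- Either the first vector is zero, which gives at most 9N² pairs, or its larger coordinate is the
first or the second, which gives at most 27N²(1 + log N) pairs each: 9 + 27 + 27 = 63. -/
lemma card_orthPairs_le {N : ℕ} (hN : 1 ≤ N) :
    ((orthPairs N).card : ℝ) ≤ 63 * N ^ 2 * (1 + Real.log N) := by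
  classical
  set f₁ : (Σ _ : ℕ, ℤ × (ℤ × ℤ)) → (ℤ × ℤ) × (ℤ × ℤ) := fun q =>
    ((q.2.2.1 * q.1, q.2.2.1 * q.2.1), (-(q.2.2.2 * q.2.1), q.2.2.2 * q.1)) with hf₁
  set f₂ : (Σ _ : ℕ, ℤ × (ℤ × ℤ)) → (ℤ × ℤ) × (ℤ × ℤ) := fun q =>
    ((q.2.2.1 * q.2.1, q.2.2.1 * q.1), (q.2.2.2 * q.1, -(q.2.2.2 * q.2.1))) with hf₂
  have hsub : orthPairs N ⊆ ({((0 : ℤ), (0 : ℤ))} : Finset (ℤ × ℤ)) ×ˢ (intBox N ×ˢ intBox N) ∪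
      ((orthParams N).image f₁ ∪ (orthParams N).image f₂) := by
    rintro ⟨⟨a, b⟩, ⟨c, d⟩⟩ hq
    simp only [orthPairs, Finset.mem_filter, Finset.mem_product, mem_intBox] at hq
    obtain ⟨⟨⟨ha, hb⟩, hc, hd⟩, h⟩ := hq
    simp only [Finset.mem_union]
    by_cases h0 : a = 0 ∧ b = 0
    · left
      simp [h0.1, h0.2, mem_intBox, hc, hd]
    right
    rcases le_total |b| |a| with hab | hab
    · left
      have ha0 : a ≠ 0 := by
        rintro rfl
        exact h0 ⟨rfl, by simpa using hab⟩
      obtain ⟨q, hq, e1, e2, e3, e4⟩ := exists_orthParams ha0 hab ha hd h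
      exact Finset.mem_image.2 ⟨q, hq, by rw [hf₁, e1, e2, e3, e4]⟩
    · right
      have hb0 : b ≠ 0 := by
        rintro rfl
        exact h0 ⟨by simpa using hab, rfl⟩
      obtain ⟨q, hq, e1, e2, e3, e4⟩ := exists_orthParams hb0 hab hb hc
        (by linarith : b * d + a * c = 0)
      exact Finset.mem_image.2 ⟨q, hq, by rw [hf₂, e1, e2, e3, e4]⟩
  have hcard := (Finset.card_le_card hsub).trans ((Finset.card_union_le _ _).trans
    (Nat.add_le_add_left ((Finset.card_union_le _ _).trans
      (Nat.add_le_add Finset.card_image_le Finset.card_image_le)) _))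
  simp only [Finset.card_product, Finset.card_singleton, one_mul, card_intBox] at hcard
  have hcard' : ((orthPairs N).card : ℝ) ≤ (2 * N + 1) * (2 * N + 1) +
      ((orthParams N).card + (orthParams N).card) := by exact_mod_cast hcard
  have hp := card_orthParams_le N
  have hN' : (1 : ℝ) ≤ N := by exact_mod_cast hN
  have hlog : 0 ≤ Real.log N := Real.log_nonneg hN'
  nlinarith [mul_nonneg (sq_nonneg (N : ℝ)) hlog]

/-- After translation this is twice a harmonic sum up to 2N. The term i + j = 0 contributes nothing
because 0⁻¹ = 0. -/
lemma sum_abs_inv_le {N : ℕ} {i : ℤ} (hi : |i| ≤ N) :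
    ∑ j ∈ intBox N, |((i + j : ℤ) : ℝ)|⁻¹ ≤ 2 * (1 + Real.log (2 * N)) := by
  have h1 : ∑ j ∈ intBox N, |((i + j : ℤ) : ℝ)|⁻¹ ≤ ∑ k ∈ intBox (2 * N), |(k : ℝ)|⁻¹ := by
    have : ∑ j ∈ intBox N, |((i + j : ℤ) : ℝ)|⁻¹ =
        ∑ k ∈ (intBox N).map (addLeftEmbedding i), |(k : ℝ)|⁻¹ := by
      rw [Finset.sum_map]; rfl
    rw [this]
    refine Finset.sum_le_sum_of_subset_of_nonneg ?_ fun _ _ _ => by positivity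
    intro k hk
    obtain ⟨j, hj, rfl⟩ := Finset.mem_map.1 hk
    rw [mem_intBox] at hj ⊢
    have := abs_add_le i j
    simp only [addLeftEmbedding_apply]
    push_cast
    linarith
  have h2 : intBox (2 * N) ⊆ {0} ∪ ((Finset.Icc 1 (2 * N)).image (fun n : ℕ => (n : ℤ)) ∪
      (Finset.Icc 1 (2 * N)).image (fun n : ℕ => -(n : ℤ))) := by
    intro k hk
    rw [mem_intBox] at hk
    simp only [Finset.mem_union, Finset.mem_singleton, Finset.mem_image, Finset.mem_Icc]
    rcases lt_trichotomy k 0 with h | h | h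
    · refine Or.inr (Or.inr ⟨k.natAbs, ?_, ?_⟩)
      · rw [abs_of_neg h] at hk; omega
      · omega
    · exact Or.inl h
    · refine Or.inr (Or.inl ⟨k.natAbs, ?_, ?_⟩)
      · rw [abs_of_pos h] at hk; omega
      · omega
  have hnn : ∀ k : ℤ, 0 ≤ |(k : ℝ)|⁻¹ := fun k => by positivity
  have h3 : ∑ k ∈ intBox (2 * N), |(k : ℝ)|⁻¹ ≤
      ∑ k ∈ ({0} : Finset ℤ), |(k : ℝ)|⁻¹ +
      (∑ k ∈ (Finset.Icc 1 (2 * N)).image (fun n : ℕ => (n : ℤ)), |(k : ℝ)|⁻¹ +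
        ∑ k ∈ (Finset.Icc 1 (2 * N)).image (fun n : ℕ => -(n : ℤ)), |(k : ℝ)|⁻¹) := by
    refine (Finset.sum_le_sum_of_subset_of_nonneg h2 fun _ _ _ => hnn _).trans ?_
    have hu : ∀ s t : Finset ℤ, ∑ k ∈ s ∪ t, |(k : ℝ)|⁻¹ ≤
        ∑ k ∈ s, |(k : ℝ)|⁻¹ + ∑ k ∈ t, |(k : ℝ)|⁻¹ := by
      intro s t
      rw [← Finset.sum_union_inter]
      exact le_add_of_nonneg_right (Finset.sum_nonneg fun _ _ => hnn _)
    exact (hu _ _).trans (add_le_add_right (hu _ _) _)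
  have h4 := sum_inv_le (2 * N)
  rw [Finset.sum_image (fun a _ b _ h => by simpa using h),
    Finset.sum_image (fun a _ b _ h => by simpa using h)] at h3
  simp only [Finset.sum_singleton, Int.cast_zero, abs_zero, inv_zero, Int.cast_natCast,
    Int.cast_neg, abs_neg, Nat.abs_cast] at h3
  push_cast at h4
  linarith

/-- Let τ(i) count the factorizations i = ab in the box. The sum is Σ τ(i)τ(j)/|i + j|; replacing
τ(i)τ(j) by (τ(i)² + τ(j)²)/2 decouples it into Σ τ(i)² times a harmonic sum. The first factor
counts solutions of ab = cd, that is, orthogonal pairs. This loses only log² N, with no pointwise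
divisor bound. -/
lemma sum_sum_inv_le {N : ℕ} (hN : 1 ≤ N) :
    ∑ p ∈ intBox N ×ˢ intBox N, ∑ q ∈ intBox N ×ˢ intBox N,
      |((p.1 * p.2 + q.1 * q.2 : ℤ) : ℝ)|⁻¹ ≤ 252 * N ^ 2 * (1 + Real.log N) ^ 2 := by
  classical
  set B := intBox N ×ˢ intBox N with hB
  set V := intBox (N ^ 2) with hV
  set τ : ℤ → ℝ := fun i => ((B.filter fun p => p.1 * p.2 = i).card : ℝ) with hτ
  have hmaps : ∀ p ∈ B, p.1 * p.2 ∈ V := by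
    intro p hp
    rw [hB, Finset.mem_product, mem_intBox, mem_intBox] at hp
    rw [hV, mem_intBox, abs_mul, sq]
    push_cast
    exact mul_le_mul hp.1 hp.2 (abs_nonneg _) (by positivity)
  have hfib : ∀ g : ℤ → ℝ, ∑ p ∈ B, g (p.1 * p.2) = ∑ i ∈ V, τ i * g i := by
    intro g
    rw [← Finset.sum_fiberwise_of_maps_to hmaps]
    refine Finset.sum_congr rfl fun i _ => ?_
    rw [Finset.sum_congr rfl (g := fun _ => g i)
      (fun p hp => by rw [(Finset.mem_filter.1 hp).2]), Finset.sum_const, nsmul_eq_mul]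
  set w : ℤ → ℝ := fun k => |(k : ℝ)|⁻¹ with hw
  have hwn : ∀ k, 0 ≤ w k := fun k => by rw [hw]; positivity
  have hN' : (1 : ℝ) ≤ N := by exact_mod_cast hN
  have hlog : 0 ≤ Real.log N := Real.log_nonneg hN'
  have hsum : ∀ i ∈ V, ∑ j ∈ V, w (i + j) ≤ 4 * (1 + Real.log N) := by
    intro i hi
    have h := sum_abs_inv_le (mem_intBox.1 hi)
    have e : Real.log (2 * ((N ^ 2 : ℕ) : ℝ)) = Real.log 2 + 2 * Real.log N := by
      push_cast
      rw [Real.log_mul (by norm_num) (by positivity), Real.log_pow]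
      norm_num
    rw [e] at h
    have := Real.log_two_lt_d9
    refine h.trans ?_
    linarith
  have henergy : ∑ i ∈ V, τ i * τ i ≤ 63 * N ^ 2 * (1 + Real.log N) := by
    rw [← hfib τ]
    refine le_trans ?_ (card_orthPairs_le hN)
    have e : ∑ p ∈ B, τ (p.1 * p.2) =
        (((B ×ˢ B).filter fun r => r.2.1 * r.2.2 = r.1.1 * r.1.2).card : ℝ) := by
      rw [Finset.card_filter, Finset.sum_product B B, Nat.cast_sum]
      refine Finset.sum_congr rfl fun p _ => ?_
      rw [hτ]
      simp only [Finset.card_filter]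
    rw [e]
    norm_cast
    -- A solution of ab = cd is sent to the orthogonal vectors (a, c) and (b, -d).
    refine Finset.card_le_card_of_injOn
      (fun r => ((r.1.1, r.2.1), (r.1.2, -r.2.2))) ?_ ?_
    · rintro ⟨⟨a, b⟩, c, d⟩ hr
      simp only [hB, Finset.coe_filter, Finset.mem_product, mem_intBox, Set.mem_ofPred_eq,
        orthPairs, abs_neg] at hr ⊢
      obtain ⟨⟨⟨h1, h2⟩, h3, h4⟩, h5⟩ := hr
      exact ⟨⟨⟨h1, h3⟩, h2, h4⟩, by linarith⟩
    · rintro ⟨⟨a, b⟩, c, d⟩ _ ⟨⟨a', b'⟩, c', d'⟩ _ h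
      simp only [Prod.mk.injEq, neg_inj] at h
      obtain ⟨⟨h1, h2⟩, h3, h4⟩ := h
      rw [h1, h2, h3, h4]
  have hS : ∑ p ∈ B, ∑ q ∈ B, w (p.1 * p.2 + q.1 * q.2) =
      ∑ i ∈ V, ∑ j ∈ V, τ i * τ j * w (i + j) := by
    rw [Finset.sum_congr rfl fun p _ => hfib fun j => w (p.1 * p.2 + j)]
    rw [hfib fun i => ∑ j ∈ V, τ j * w (i + j)]
    refine Finset.sum_congr rfl fun i _ => ?_
    rw [Finset.mul_sum]
    exact Finset.sum_congr rfl fun j _ => by ring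
  have hT : ∑ i ∈ V, ∑ j ∈ V, τ i * τ i * w (i + j) ≤
      252 * N ^ 2 * (1 + Real.log N) ^ 2 := by
    calc _ = ∑ i ∈ V, τ i * τ i * ∑ j ∈ V, w (i + j) := by simp_rw [Finset.mul_sum]
      _ ≤ ∑ i ∈ V, τ i * τ i * (4 * (1 + Real.log N)) := by
        refine Finset.sum_le_sum fun i hi => ?_
        exact mul_le_mul_of_nonneg_left (hsum i hi) (mul_self_nonneg _)
      _ = (∑ i ∈ V, τ i * τ i) * (4 * (1 + Real.log N)) := by rw [Finset.sum_mul]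
      _ ≤ 63 * N ^ 2 * (1 + Real.log N) * (4 * (1 + Real.log N)) := by gcongr
      _ = _ := by ring
  have hT' : ∑ i ∈ V, ∑ j ∈ V, τ j * τ j * w (i + j) =
      ∑ i ∈ V, ∑ j ∈ V, τ i * τ i * w (i + j) := by
    rw [Finset.sum_comm]
    exact Finset.sum_congr rfl fun i _ => Finset.sum_congr rfl fun j _ => by rw [add_comm]
  have hamgm : ∑ i ∈ V, ∑ j ∈ V, τ i * τ j * w (i + j) ≤
      ∑ i ∈ V, ∑ j ∈ V, (τ i * τ i * w (i + j) / 2 + τ j * τ j * w (i + j) / 2) := by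
    refine Finset.sum_le_sum fun i _ => Finset.sum_le_sum fun j _ => ?_
    have : τ i * τ j ≤ (τ i * τ i + τ j * τ j) / 2 := by nlinarith [sq_nonneg (τ i - τ j)]
    have := mul_le_mul_of_nonneg_right this (hwn (i + j))
    linarith
  simp_rw [Finset.sum_add_distrib, ← Finset.sum_div] at hamgm
  calc _ = ∑ p ∈ B, ∑ q ∈ B, w (p.1 * p.2 + q.1 * q.2) := rfl
    _ ≤ _ := by rw [hS]; linarith

/-! ### The lattice of mesh 1/L -/

/-- The point `n / L` of the lattice of mesh `1 / L`. -/
def latticePoint (L : ℝ) (n : ℤ × ℤ) : Plane := !₂[(n.1 : ℝ) / L, (n.2 : ℝ) / L]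

@[simp] lemma latticePoint_zero (L : ℝ) (n : ℤ × ℤ) : latticePoint L n 0 = n.1 / L := by
  simp [latticePoint]

@[simp] lemma latticePoint_one (L : ℝ) (n : ℤ × ℤ) : latticePoint L n 1 = n.2 / L := by
  simp [latticePoint]

lemma mem_lattice {L : ℝ} {K : Plane} : K ∈ lattice L ↔ ∃ n, K = latticePoint L n := by
  constructor
  · rintro ⟨n, hn⟩
    refine ⟨(n 0, n 1), ?_⟩
    ext j
    fin_cases j
    · simpa using hn 0
    · simpa using hn 1
  · rintro ⟨n, rfl⟩
    refine ⟨![n.1, n.2], fun j => ?_⟩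
    fin_cases j <;> simp

lemma add_mem_lattice {L : ℝ} {K K' : Plane} (h : K ∈ lattice L) (h' : K' ∈ lattice L) :
    K + K' ∈ lattice L := by
  obtain ⟨n, hn⟩ := h
  obtain ⟨m, hm⟩ := h'
  exact ⟨n + m, fun j => by simp [hn, hm, add_div]⟩

lemma sub_mem_lattice {L : ℝ} {K K' : Plane} (h : K ∈ lattice L) (h' : K' ∈ lattice L) :
    K - K' ∈ lattice L := by
  obtain ⟨n, hn⟩ := h
  obtain ⟨m, hm⟩ := h'
  exact ⟨n - m, fun j => by simp [hn, hm, sub_div]⟩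

lemma latticePoint_injective {L : ℝ} (hL : 0 < L) : Function.Injective (latticePoint L) := by
  intro n m h
  have h0 : latticePoint L n 0 = latticePoint L m 0 := by rw [h]
  have h1 : latticePoint L n 1 = latticePoint L m 1 := by rw [h]
  simp only [latticePoint_zero, latticePoint_one] at h0 h1
  rw [div_left_inj' hL.ne'] at h0 h1
  exact Prod.ext (by exact_mod_cast h0) (by exact_mod_cast h1)

lemma mem_intBox_of_norm_le {L R : ℝ} (hL : 0 < L) {n : ℤ × ℤ}
    (h : ‖latticePoint L n‖ ≤ R) : n ∈ intBox ⌊R * L⌋₊ ×ˢ intBox ⌊R * L⌋₊ := by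
  have key : ∀ a : ℤ, |(a : ℝ) / L| ≤ R → a ∈ intBox ⌊R * L⌋₊ := by
    intro a ha
    rw [mem_intBox]
    rw [abs_div, abs_of_pos hL, div_le_iff₀ hL] at ha
    have h1 : ((a.natAbs : ℕ) : ℝ) ≤ R * L := by
      rw [Nat.cast_natAbs, Int.cast_abs]; exact ha
    have := Nat.le_floor h1
    rw [← Int.natCast_natAbs]
    exact_mod_cast this
  rw [Finset.mem_product]
  constructor
  · exact key _ (by simpa using (abs_coord_le _ 0).trans h)
  · exact key _ (by simpa using (abs_coord_le _ 1).trans h)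

open Classical in
/-- The lattice points in the closed ball of radius `R`. -/
def latticeBall (L R : ℝ) : Finset Plane :=
  ((intBox ⌊R * L⌋₊ ×ˢ intBox ⌊R * L⌋₊).image (latticePoint L)).filter fun K => ‖K‖ ≤ R

lemma mem_latticeBall {L R : ℝ} (hL : 0 < L) {K : Plane} :
    K ∈ latticeBall L R ↔ K ∈ lattice L ∧ ‖K‖ ≤ R := by
  rw [latticeBall, Finset.mem_filter, Finset.mem_image, mem_lattice]
  constructor
  · rintro ⟨⟨n, -, rfl⟩, h⟩
    exact ⟨⟨n, rfl⟩, h⟩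
  · rintro ⟨⟨n, rfl⟩, h⟩
    exact ⟨⟨n, mem_intBox_of_norm_le hL h, rfl⟩, h⟩

lemma card_latticeBall_le {L R : ℝ} (hL : 1 ≤ L) (hR : 1 ≤ R) :
    ((latticeBall L R).card : ℝ) ≤ 9 * R ^ 2 * L ^ 2 := by
  have h : (latticeBall L R).card ≤ (2 * ⌊R * L⌋₊ + 1) * (2 * ⌊R * L⌋₊ + 1) := by
    rw [latticeBall]
    refine (Finset.card_filter_le _ _).trans (Finset.card_image_le.trans ?_)
    rw [Finset.card_product, card_intBox]
  have h' : ((latticeBall L R).card : ℝ) ≤ (2 * ⌊R * L⌋₊ + 1) * (2 * ⌊R * L⌋₊ + 1) := by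
    exact_mod_cast h
  have h1 : 1 ≤ R * L := one_le_mul_of_one_le_of_one_le hR hL
  have h2 : (⌊R * L⌋₊ : ℝ) ≤ R * L := Nat.floor_le (by linarith)
  calc _ ≤ _ := h'
    _ ≤ (3 * (R * L)) * (3 * (R * L)) := by gcongr <;> linarith
    _ = _ := by ring

lemma one_div_le_norm {L : ℝ} (hL : 0 < L) {P : Plane} (hP : P ∈ lattice L) (h0 : P ≠ 0) :
    1 / L ≤ ‖P‖ := by
  obtain ⟨n, hn⟩ := hP
  have : ∃ j, n j ≠ 0 := by
    by_contra! h
    exact h0 (by ext j; simp [hn, h])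
  obtain ⟨j, hj⟩ := this
  refine le_trans ?_ (abs_coord_le P j)
  rw [hn, abs_div, abs_of_pos hL]
  refine div_le_div_of_nonneg_right ?_ hL.le
  rw [← Int.cast_abs]
  exact_mod_cast Int.one_le_abs hj

/-! ### Error estimates for a single triple -/

lemma continuous_packet {h σ : ℝ} (hh : 0 < h) (hσ : 0 < σ) (K : Plane)
    (p : Plane × Plane × Plane) : Continuous (packet h σ K p) := by
  have h1 := continuous_damp h
  have h2 := continuous_smear h σ
  have h3 := smear_ne_zero hh hσ
  have he : ∀ a b c d, Continuous fun s => exponent h σ s a b c d := by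
    intro a b c d
    unfold exponent
    refine Continuous.sub (Continuous.add (by fun_prop) ?_) (by fun_prop)
    exact Continuous.div (by fun_prop) h2 h3
  unfold packet
  exact Continuous.mul (Continuous.div (by fun_prop) h2 h3)
    (Complex.continuous_exp.comp ((he _ _ _ _).add (he _ _ _ _)))

lemma continuous_deviation {h σ : ℝ} (hh : 0 < h) (hσ : 0 < σ) (x y : ℝ) :
    Continuous (deviation h σ x y) := by
  have h1 := continuous_damp h
  have h2 := continuous_smear h σ
  unfold deviation slowExponent
  fun_prop (disch := exact smear_ne_zero hh hσ)

lemma mul_sq_le_one_of_le {L σ t : ℝ} (hL : 1 ≤ L) (hσ : 0 < σ) (ht : 0 ≤ t)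
    (htσ : t ≤ 1 / (σ ^ 2 * L ^ 2)) : t * σ ^ 2 ≤ 1 := by
  rw [le_div_iff₀ (by positivity)] at htσ
  have : 1 ≤ L ^ 2 := one_le_pow₀ hL
  have : 0 ≤ t * σ ^ 2 := by positivity
  nlinarith

lemma norm_integral_packet_le {h L σ t R : ℝ} {K : Plane} {p : Plane × Plane × Plane}
    (hh : 0 < h) (hL : 200 ≤ L) (hσ : 0 < σ) (hr : 16 * h ≤ σ) (hR : 1 ≤ R) (ht : 0 ≤ t)
    (htσ : t ≤ 1 / (σ ^ 2 * L ^ 2)) (hp₁ : ‖p.1‖ ≤ R) (hp₂ : ‖p.2.1‖ ≤ R) (hp₃ : ‖p.2.2‖ ≤ R)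
    (hP : 1 / L ≤ ‖p.1 - p.2.1 + p.2.2 - K‖) :
    ‖∫ s in (0 : ℝ)..t, packet h σ K p s‖ ≤
      2 * Real.exp (-(1 / (2 * σ ^ 2 * L ^ 2)) + 20000 * R ^ 2 * (t + h ^ 2 / σ ^ 4)) := by
  have hL0 : 0 < L := by linarith
  have htσ1 := mul_sq_le_one_of_le (by linarith) hσ ht htσ
  have hrat := ratio_sq_le hh hσ hr
  set P := p.1 - p.2.1 + p.2.2 - K with hPd
  have hPup : ‖P‖ ≤ 3 * R + ‖K‖ := by
    refine (norm_sub_le _ _).trans ?_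
    have := norm_add_le (p.1 - p.2.1) p.2.2
    have := norm_sub_le p.1 p.2.1
    linarith
  have hPlow : ‖K‖ ≤ ‖P‖ + 3 * R := by
    have e : K = p.1 - p.2.1 + p.2.2 - P := by rw [hPd]; abel
    have h1 := norm_sub_le (p.1 - p.2.1 + p.2.2) P
    rw [← e] at h1
    have := norm_add_le (p.1 - p.2.1) p.2.2
    have := norm_sub_le p.1 p.2.1
    linarith
  have hb : ∀ s ∈ Set.uIoc 0 t, ‖packet h σ K p s‖ ≤
      2 * Real.exp (-(1 / (2 * σ ^ 2 * L ^ 2)) + 19999 * R ^ 2 * (t + h ^ 2 / σ ^ 4)) := by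
    intro s hs
    rw [Set.uIoc_of_le ht] at hs
    have hs0 := hs.1.le
    have hst := hs.2
    have hsσ : s * σ ^ 2 ≤ 1 := le_trans (by gcongr) htσ1
    have hD : ∀ q : Plane, ‖q‖ ≤ R → ‖q - K‖ ≤ R + ‖K‖ := fun q hq =>
      (norm_sub_le _ _).trans (by linarith)
    refine (norm_packet_le hh hσ hs0 hr hsσ (hD _ hp₁) (hD _ hp₂) (hD _ hp₃)).trans ?_
    rw [← hPd]
    gcongr 2 * Real.exp ?_
    have hhσ : 0 ≤ h ^ 2 / σ ^ 4 := by positivity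
    -- The bound must be uniform in K. For bounded K all distances are O(R) and the error terms go
    -- into the constant. For distant K, |P| is comparable to |K|, and the errors are absorbed by
    -- part of the Gaussian decay.
    rcases le_total ‖K‖ (6 * R) with hK | hK
    · have i1 : -‖P‖ ^ 2 / (2 * σ ^ 2) ≤ -(1 / (2 * σ ^ 2 * L ^ 2)) := by
        rw [neg_div, neg_le_neg_iff]
        have e : 1 / (2 * σ ^ 2 * L ^ 2) = (1 / L) ^ 2 / (2 * σ ^ 2) := by field_simp
        rw [e]
        gcongr
      have i2 : 27 * ‖P‖ ^ 2 * (h ^ 2 / σ ^ 4) ≤ 27 * (9 * R) ^ 2 * (h ^ 2 / σ ^ 4) := by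
        gcongr; linarith
      have i3 : 72 * s * (‖P‖ * (R + ‖K‖)) ≤ 72 * t * ((9 * R) * (7 * R)) := by
        gcongr <;> linarith
      have i4 : 216 * s * (R + ‖K‖) ^ 2 ≤ 216 * t * (7 * R) ^ 2 := by
        gcongr; linarith
      have : 0 ≤ R ^ 2 * t := by positivity
      have : 0 ≤ R ^ 2 * (h ^ 2 / σ ^ 4) := by positivity
      linarith
    · have hP3 : 3 * R ≤ ‖P‖ := by linarith
      have hD4 : R + ‖K‖ ≤ 4 * ‖P‖ := by linarith
      -- L ≥ 200 gives L² ≥ 40000, so the three errors add up to less than |P|²/(4σ²), half of the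
      -- decay.
      have hsL : s ≤ 1 / 40000 * (1 / σ ^ 2) := by
        refine (hst.trans htσ).trans ?_
        have : 1 / (σ ^ 2 * L ^ 2) = 1 / L ^ 2 * (1 / σ ^ 2) := by field_simp
        rw [this]
        gcongr
        nlinarith
      have i2 : 27 * ‖P‖ ^ 2 * (h ^ 2 / σ ^ 4) ≤ 27 * ‖P‖ ^ 2 * (1 / 256 * (1 / σ ^ 2)) := by
        have : h ^ 2 / σ ^ 4 = h ^ 2 / σ ^ 2 * (1 / σ ^ 2) := by field_simp
        rw [this]
        gcongr
      have i3 : 72 * s * (‖P‖ * (R + ‖K‖)) ≤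
          72 * (1 / 40000 * (1 / σ ^ 2)) * (‖P‖ * (4 * ‖P‖)) := by gcongr
      have i4 : 216 * s * (R + ‖K‖) ^ 2 ≤
          216 * (1 / 40000 * (1 / σ ^ 2)) * (4 * ‖P‖) ^ 2 := by gcongr
      have hP9 : 1 ≤ ‖P‖ ^ 2 := one_le_pow₀ (by linarith)
      have e1 : -‖P‖ ^ 2 / (2 * σ ^ 2) = -(1 / 2) * (‖P‖ ^ 2 * (1 / σ ^ 2)) := by field_simp
      have e2 : 1 / (2 * σ ^ 2 * L ^ 2) ≤ 1 / 4 * (‖P‖ ^ 2 * (1 / σ ^ 2)) := by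
        calc 1 / (2 * σ ^ 2 * L ^ 2) = 1 / 2 * (1 / L ^ 2) * (1 / σ ^ 2) := by field_simp
          _ ≤ 1 / 2 * (1 / 2) * (1 / σ ^ 2) := by gcongr; nlinarith
          _ = 1 / 4 * (1 * (1 / σ ^ 2)) := by ring
          _ ≤ _ := by gcongr
      have : 0 ≤ 19999 * R ^ 2 * (t + h ^ 2 / σ ^ 4) := by positivity
      have : 0 ≤ ‖P‖ ^ 2 * (1 / σ ^ 2) := by positivity
      rw [e1]
      linarith
  refine (intervalIntegral.norm_integral_le_of_norm_le_const hb).trans ?_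
  rw [sub_zero, abs_of_nonneg ht]
  -- The length t of the time interval is absorbed into the exponential, which accounts for passing
  -- from 19999 to 20000.
  have hte : t ≤ Real.exp t := by linarith [Real.add_one_le_exp t]
  calc _ ≤ 2 * Real.exp (-(1 / (2 * σ ^ 2 * L ^ 2)) + 19999 * R ^ 2 * (t + h ^ 2 / σ ^ 4)) *
        Real.exp t := by gcongr
    _ = 2 * Real.exp (-(1 / (2 * σ ^ 2 * L ^ 2)) + 19999 * R ^ 2 * (t + h ^ 2 / σ ^ 4) + t) := by
      rw [mul_assoc, ← Real.exp_add]
    _ ≤ _ := by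
      gcongr 2 * Real.exp ?_
      have : 1 ≤ R ^ 2 := one_le_pow₀ hR
      have : 0 ≤ h ^ 2 / σ ^ 4 := by positivity
      nlinarith

/-- Subtracting the oscillation, itself an integral of the phase, leaves the phase times
`deviation`. Because 0⁻¹ = 0, exactly one of the two summands in the last factor is active: the
indicator at an exact resonance, the inverse otherwise. -/
lemma norm_integral_packet_sub_le {h L σ t R : ℝ} {K : Plane} {p : Plane × Plane × Plane}
    (hh : 0 < h) (hL : 1 ≤ L) (hσ : 0 < σ) (hr : 16 * h ≤ σ) (hR : 1 ≤ R) (ht : 0 ≤ t)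
    (htσ : t ≤ 1 / (σ ^ 2 * L ^ 2)) (hp₁ : ‖p.1‖ ≤ R) (hp₂ : ‖p.2.1‖ ≤ R) (hp₃ : ‖p.2.2‖ ≤ R)
    (hK : K = p.1 - p.2.1 + p.2.2) :
    ‖(∫ s in (0 : ℝ)..t, packet h σ K p s) - oscillation t (resonance p.1 p.2.1 p.2.2 K)‖ ≤
      2000 * R ^ 2 * (h ^ 2 / σ ^ 2 + t * h ^ 2 + t ^ 2 * h ^ 2) *
        ((if resonance p.1 p.2.1 p.2.2 K = 0 then t else 0) +
          |resonance p.1 p.2.1 p.2.2 K|⁻¹) := by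
  have htσ1 := mul_sq_le_one_of_le hL hσ ht htσ
  set ω := resonance p.1 p.2.1 p.2.2 K with hω
  set x := ‖p.2.1 - K‖ ^ 2 with hx
  set y := ‖p.1 - K‖ ^ 2 + ‖p.2.2 - K‖ ^ 2 with hy
  have hx0 : 0 ≤ x := by positivity
  have hy0 : 0 ≤ y := by positivity
  have hKn : ‖K‖ ≤ 3 * R := by
    have := norm_add_le (p.1 - p.2.1) p.2.2
    have := norm_sub_le p.1 p.2.1
    rw [hK]; linarith
  have hxy : x + y ≤ 48 * R ^ 2 := by
    have hD : ∀ q : Plane, ‖q‖ ≤ R → ‖q - K‖ ^ 2 ≤ 16 * R ^ 2 := by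
      intro q hq
      have h1 : ‖q - K‖ ≤ 4 * R := (norm_sub_le _ _).trans (by linarith)
      calc _ ≤ (4 * R) ^ 2 := by gcongr
        _ = _ := by ring
    have := hD _ hp₁
    have := hD _ hp₂
    have := hD _ hp₃
    linarith
  set E := h ^ 2 / σ ^ 2 + t * h ^ 2 + t ^ 2 * h ^ 2 with hE
  have n1 : 0 ≤ h ^ 2 / σ ^ 2 := by positivity
  have n2 : 0 ≤ t * h ^ 2 := by positivity
  have n3 : 0 ≤ t ^ 2 * h ^ 2 := by positivity
  have hR2 : 1 ≤ R ^ 2 := one_le_pow₀ hR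
  have hdev : (∫ s in (0 : ℝ)..t, packet h σ K p s) - oscillation t ω =
      ∫ s in (0 : ℝ)..t, Complex.exp (-(Complex.I * s * ω)) * deviation h σ x y s := by
    rw [oscillation_eq_integral, ← intervalIntegral.integral_sub
      ((continuous_packet hh hσ K p).intervalIntegrable _ _)
      (Continuous.intervalIntegrable (by fun_prop) _ _)]
    congr 1
    funext s
    rw [packet_resonant hK]
    ring
  have hC1 : ∀ s ∈ Set.Icc 0 t, C1Bound (deviation h σ x y) s (288 * R ^ 2 * E)
      (1152 * R ^ 2 * (t * h ^ 2) + 60 * h ^ 2) := by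
    intro s hs
    obtain ⟨hs0, hst⟩ := hs
    have hsσ : s * σ ^ 2 ≤ 1 := le_trans (by gcongr) htσ1
    refine (C1Bound_deviation hh hσ hs0 hr hsσ hx0 hy0).mono ?_ ?_
    · calc _ ≤ 6 * t ^ 2 * h ^ 2 * (48 * R ^ 2) + 12 * (t * h ^ 2) + 18 * (h ^ 2 / σ ^ 2) := by
            gcongr
        _ ≤ _ := by
          rw [hE]
          nlinarith
    · calc _ ≤ 24 * t * h ^ 2 * (48 * R ^ 2) + 60 * h ^ 2 := by gcongr
        _ = _ := by ring
  rw [hdev]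
  have hR2E : 0 ≤ R ^ 2 * E := by positivity
  by_cases h0 : ω = 0
  · rw [if_pos h0, h0, abs_zero, inv_zero, add_zero]
    have := intervalIntegral.norm_integral_le_of_norm_le_const (a := 0) (b := t)
      (f := fun s : ℝ => Complex.exp (-(Complex.I * s * ((0 : ℝ) : ℂ))) * deviation h σ x y s)
      (C := 288 * R ^ 2 * E) (fun s hs => by
        rw [Set.uIoc_of_le ht] at hs
        simpa using (hC1 s ⟨hs.1.le, hs.2⟩).1)
    refine this.trans ?_
    rw [sub_zero, abs_of_nonneg ht]
    nlinarith
  · rw [if_neg h0, zero_add]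
    refine (norm_integral_exp_mul_le h0 ht (continuous_deviation hh hσ x y) hC1).trans ?_
    rw [div_eq_mul_inv]
    gcongr
    rw [hE]
    nlinarith

/-! ### Summation over resonant triples -/

lemma resonance_eq {L : ℝ} (hL : 0 < L) (K : Plane) (n m : ℤ × ℤ) :
    resonance (K + latticePoint L n) (K + latticePoint L n + latticePoint L m)
      (K + latticePoint L m) K = -2 * ((n.1 * m.1 + n.2 * m.2 : ℤ) : ℝ) / L ^ 2 := by
  simp only [resonance, norm_sq_eq, PiLp.add_apply, latticePoint_zero, latticePoint_one]
  push_cast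
  field_simp
  ring

-- Triples with K = K₁ - K₂ + K₃ are parametrized by n = L(K₁ - K) and m = L(K₃ - K). If such a
-- triple lies in the ball of radius R then |K| ≤ 3R, so n and m have entries at most 4RL, uniformly
-- in K.
open Classical in
lemma sum_resonant_le {L R t : ℝ} {K : Plane} (hL : 3 ≤ L) (hR : 1 ≤ R) (ht : 0 ≤ t)
    (hK : K ∈ lattice L) :
    ∑ p ∈ (latticeBall L R ×ˢ latticeBall L R ×ˢ latticeBall L R).filter
        (fun p => K = p.1 - p.2.1 + p.2.2),
      ((if resonance p.1 p.2.1 p.2.2 K = 0 then t else 0) +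
        |resonance p.1 p.2.1 p.2.2 K|⁻¹) ≤
      2016 * R ^ 2 * (2 + Real.log (4 * R)) ^ 2 *
        (t * L ^ 2 * Real.log L + L ^ 4 * Real.log L ^ 2) := by
  have hL0 : 0 < L := by linarith
  set N := ⌊4 * R * L⌋₊ with hN
  set B := intBox N ×ˢ intBox N with hB
  set g : (ℤ × ℤ) × (ℤ × ℤ) → Plane × Plane × Plane := fun q =>
    (K + latticePoint L q.1, K + latticePoint L q.1 + latticePoint L q.2,
      K + latticePoint L q.2) with hg
  have hginj : Function.Injective g := by
    rintro ⟨n, m⟩ ⟨n', m'⟩ h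
    simp only [hg, Prod.mk.injEq, add_right_inj] at h
    exact Prod.ext (latticePoint_injective hL0 h.1) (latticePoint_injective hL0 h.2.2)
  have hsub : (latticeBall L R ×ˢ latticeBall L R ×ˢ latticeBall L R).filter
        (fun p => K = p.1 - p.2.1 + p.2.2) ⊆ (B ×ˢ B).image g := by
    rintro ⟨p₁, p₂, p₃⟩ hp
    simp only [Finset.mem_filter, Finset.mem_product, mem_latticeBall hL0] at hp
    obtain ⟨⟨⟨l₁, b₁⟩, ⟨l₂, b₂⟩, ⟨l₃, b₃⟩⟩, hKp⟩ := hp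
    have hKn : ‖K‖ ≤ 3 * R := by
      have := norm_add_le (p₁ - p₂) p₃
      have := norm_sub_le p₁ p₂
      rw [hKp]; linarith
    obtain ⟨n, hn⟩ := mem_lattice.1 (sub_mem_lattice l₁ hK)
    obtain ⟨m, hm⟩ := mem_lattice.1 (sub_mem_lattice l₃ hK)
    refine Finset.mem_image.2 ⟨(n, m), Finset.mem_product.2 ⟨?_, ?_⟩, ?_⟩
    · refine mem_intBox_of_norm_le hL0 ?_
      rw [← hn]
      exact (norm_sub_le _ _).trans (by linarith)
    · refine mem_intBox_of_norm_le hL0 ?_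
      rw [← hm]
      exact (norm_sub_le _ _).trans (by linarith)
    · simp only [hg, ← hn, ← hm, Prod.mk.injEq]
      refine ⟨by abel, ?_, by abel⟩
      rw [hKp]; abel
  have hNL : (N : ℝ) ≤ 4 * R * L := Nat.floor_le (by positivity)
  have hN1 : 1 ≤ N := Nat.le_floor (by norm_num; nlinarith)
  have hN1' : (1 : ℝ) ≤ N := by exact_mod_cast hN1
  have hlogL : 1 ≤ Real.log L := by
    rw [Real.le_log_iff_exp_le hL0]
    exact (Real.exp_one_lt_d9.le.trans (by norm_num)).trans hL
  have hlogR : 0 ≤ Real.log (4 * R) := Real.log_nonneg (by linarith)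
  set c := 2 + Real.log (4 * R) with hc
  have hlogN : 1 + Real.log N ≤ c * Real.log L := by
    have h1 : Real.log N ≤ Real.log (4 * R) + Real.log L := by
      rw [← Real.log_mul (by positivity) (by positivity)]
      exact Real.log_le_log (by linarith) hNL
    rw [hc]
    nlinarith
  have hlogN0 : 0 ≤ Real.log N := Real.log_nonneg hN1'
  refine (Finset.sum_le_sum_of_subset_of_nonneg hsub fun p _ _ => ?_).trans ?_
  · split_ifs <;> positivity
  rw [Finset.sum_image hginj.injOn, Finset.sum_add_distrib]
  have hzero : ∀ k : ℤ, (-2 * (k : ℝ) / L ^ 2 = 0) ↔ k = 0 := by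
    intro k
    simp [hL0.ne']
  have hfirst : ∑ q ∈ B ×ˢ B, (if resonance (g q).1 (g q).2.1 (g q).2.2 K = 0 then t else 0) =
      t * (orthPairs N).card := by
    rw [Finset.sum_congr rfl (g := fun q : (ℤ × ℤ) × (ℤ × ℤ) =>
      if q.1.1 * q.2.1 + q.1.2 * q.2.2 = 0 then t else 0) (fun q _ => ?_)]
    · rw [← Finset.sum_filter, Finset.sum_const, nsmul_eq_mul, mul_comm, orthPairs]
    · simp only [hg, resonance_eq hL0, hzero]
  have hsecond : ∑ q ∈ B ×ˢ B, |resonance (g q).1 (g q).2.1 (g q).2.2 K|⁻¹ =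
      L ^ 2 / 2 * ∑ p ∈ B, ∑ q ∈ B, |((p.1 * p.2 + q.1 * q.2 : ℤ) : ℝ)|⁻¹ := by
    have e1 : ∀ q : (ℤ × ℤ) × (ℤ × ℤ), |resonance (g q).1 (g q).2.1 (g q).2.2 K|⁻¹ =
        L ^ 2 / 2 * |((q.1.1 * q.2.1 + q.1.2 * q.2.2 : ℤ) : ℝ)|⁻¹ := by
      intro q
      simp only [hg, resonance_eq hL0]
      rw [abs_div, abs_mul, inv_div, abs_of_pos (by positivity : 0 < L ^ 2)]
      rw [div_eq_mul_inv, mul_inv]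
      norm_num
      ring
    simp_rw [e1]
    rw [← Finset.mul_sum, hB]
    congr 1
    -- The four integers are regrouped by coordinate, (n₁, m₁) and (n₂, m₂), instead of by vector.
    simp only [Finset.sum_product]
    exact Finset.sum_congr rfl fun a _ => Finset.sum_comm
  rw [hfirst, hsecond]
  have b1 := card_orthPairs_le hN1
  have b2 := sum_sum_inv_le hN1
  have hc2 : 2 ≤ c := by rw [hc]; linarith
  calc _ ≤ t * (63 * (4 * R * L) ^ 2 * (c * Real.log L)) +
        L ^ 2 / 2 * (252 * (4 * R * L) ^ 2 * (c * Real.log L) ^ 2) := by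
        gcongr
        · refine b1.trans ?_
          gcongr
        · refine b2.trans ?_
          gcongr
    _ = R ^ 2 * (1008 * c * (t * L ^ 2 * Real.log L) +
          2016 * c ^ 2 * (L ^ 4 * Real.log L ^ 2)) := by ring
    _ ≤ R ^ 2 * (2016 * c ^ 2 * (t * L ^ 2 * Real.log L) +
          2016 * c ^ 2 * (L ^ 4 * Real.log L ^ 2)) := by
        gcongr <;> nlinarith
    _ = _ := by ring

/-! ### Bound on the remainder -/

/-- The difference between the coarse grained cubic term and the discrete interaction sum. -/
def remainder (η : Plane → ℂ) (h L σ : ℝ) (K : Plane) (t : ℝ) : ℂ :=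
  coarse (firstOrder (initialDatum η h L) t) K σ -
    (1 / (2 * (Real.pi : ℂ)) ^ 4) * interactionSum η L K t

/-- The triples with P ≠ 0 are bounded by their number, at most (9R²L²)³, times the exponentially
small bound; those with P = 0 are handled by `sum_resonant_le`. -/
lemma norm_remainder_le {η : Plane → ℂ} {M R : ℝ} (hM : ∀ K, ‖η K‖ ≤ M) (hR : 1 ≤ R)
    (hη : ∀ K, R < ‖K‖ → η K = 0) {h L σ t : ℝ} {K : Plane} (hh : 0 < h) (hL : 200 ≤ L)
    (hσ : 0 < σ) (hr : 16 * h ≤ σ) (ht : 0 ≤ t) (htσ : t ≤ 1 / (σ ^ 2 * L ^ 2))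
    (hK : K ∈ lattice L) :
    ‖remainder η h L σ K t‖ ≤
      M ^ 3 * (1458 * R ^ 6 * (L ^ 6 * Real.exp (-(1 / (2 * σ ^ 2 * L ^ 2)) +
          20000 * R ^ 2 * (t + h ^ 2 / σ ^ 4))) +
        4032000 * R ^ 4 * (2 + Real.log (4 * R)) ^ 2 *
          ((h ^ 2 / σ ^ 2 + t * h ^ 2 + t ^ 2 * h ^ 2) *
            (t * L ^ 2 * Real.log L + L ^ 4 * Real.log L ^ 2))) := by
  classical
  have hL0 : 0 < L := by linarith
  set S := latticeBall L R with hS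
  have hSl : ∀ K ∈ S, K ∈ lattice L := fun K h => ((mem_latticeBall hL0).1 h).1
  have hSη : ∀ K ∈ lattice L, K ∉ S → η K = 0 := by
    intro K hKl hKS
    refine hη K ?_
    by_contra! hn
    exact hKS ((mem_latticeBall hL0).2 ⟨hKl, hn⟩)
  have hM0 : 0 ≤ M := (norm_nonneg _).trans (hM 0)
  set T := S ×ˢ S ×ˢ S with hT
  have hTn : ∀ p ∈ T, ‖p.1‖ ≤ R ∧ ‖p.2.1‖ ≤ R ∧ ‖p.2.2‖ ≤ R := by
    intro p hp
    simp only [hT, hS, Finset.mem_product, mem_latticeBall hL0] at hp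
    exact ⟨hp.1.2, hp.2.1.2, hp.2.2.2⟩
  set X : Plane × Plane × Plane → ℂ := fun p => (∫ s in (0 : ℝ)..t, packet h σ K p s) -
    if K = p.1 - p.2.1 + p.2.2 then oscillation t (resonance p.1 p.2.1 p.2.2 K) else 0 with hX
  have hrem : remainder η h L σ K t = (1 / (2 * (Real.pi : ℂ)) ^ 4) *
      ∑ p ∈ T, η p.1 * (starRingEnd ℂ) (η p.2.1) * η p.2.2 * X p := by
    rw [remainder, coarse_firstOrder hSl hSη hh hσ ht K, interactionSum_eq hSl hSη K t,
      ← mul_sub, ← Finset.sum_sub_distrib]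
    congr 1
    exact Finset.sum_congr rfl fun p _ => by rw [hX]; ring
  have hpi : ‖(1 / (2 * (Real.pi : ℂ)) ^ 4)‖ ≤ 1 := by
    rw [norm_div, norm_one, norm_pow, norm_mul, Complex.norm_ofNat, Complex.norm_real,
      Real.norm_of_nonneg Real.pi_pos.le]
    refine div_le_one_of_le₀ (one_le_pow₀ ?_) (by positivity)
    linarith [Real.pi_gt_three]
  have hsum : ‖remainder η h L σ K t‖ ≤ M ^ 3 * ∑ p ∈ T, ‖X p‖ := by
    rw [hrem, norm_mul, Finset.mul_sum]
    refine (mul_le_of_le_one_left (norm_nonneg _) hpi).trans (norm_sum_le_of_le _ fun p _ => ?_)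
    rw [norm_mul, norm_mul, norm_mul, RCLike.norm_conj]
    calc _ ≤ M * M * M * ‖X p‖ := by gcongr <;> exact hM _
      _ = _ := by ring
  refine hsum.trans ?_
  gcongr
  rw [← Finset.sum_filter_add_sum_filter_not T (fun p => K = p.1 - p.2.1 + p.2.2), add_comm]
  refine add_le_add ?_ ?_
  · set e := Real.exp (-(1 / (2 * σ ^ 2 * L ^ 2)) + 20000 * R ^ 2 * (t + h ^ 2 / σ ^ 4)) with he
    have he0 : 0 < e := Real.exp_pos _
    have hbd : ∀ p ∈ T.filter (fun p => ¬ K = p.1 - p.2.1 + p.2.2), ‖X p‖ ≤ 2 * e := by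
      intro p hp
      rw [Finset.mem_filter] at hp
      obtain ⟨hpT, hpK⟩ := hp
      obtain ⟨b₁, b₂, b₃⟩ := hTn p hpT
      simp only [hX, if_neg hpK, sub_zero]
      refine norm_integral_packet_le hh hL hσ hr hR ht htσ b₁ b₂ b₃ ?_
      simp only [hT, Finset.mem_product] at hpT
      refine one_div_le_norm hL0 ?_ fun h0 => hpK (sub_eq_zero.1 h0).symm
      exact sub_mem_lattice (add_mem_lattice (sub_mem_lattice (hSl _ hpT.1) (hSl _ hpT.2.1))
        (hSl _ hpT.2.2)) hK
    refine (Finset.sum_le_card_nsmul _ _ _ hbd).trans ?_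
    rw [nsmul_eq_mul]
    have hc := card_latticeBall_le (by linarith : 1 ≤ L) hR
    have hTc : ((T.filter (fun p => ¬ K = p.1 - p.2.1 + p.2.2)).card : ℝ) ≤
        S.card * (S.card * S.card) := by
      have := Finset.card_filter_le T (fun p => ¬ K = p.1 - p.2.1 + p.2.2)
      rw [hT, Finset.card_product, Finset.card_product] at this
      exact_mod_cast this
    calc _ ≤ S.card * (S.card * S.card) * (2 * e) := by gcongr
      _ ≤ (9 * R ^ 2 * L ^ 2) * ((9 * R ^ 2 * L ^ 2) * (9 * R ^ 2 * L ^ 2)) * (2 * e) := by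
        gcongr
      _ = _ := by ring
  · have hbd : ∀ p ∈ T.filter (fun p => K = p.1 - p.2.1 + p.2.2), ‖X p‖ ≤
        2000 * R ^ 2 * (h ^ 2 / σ ^ 2 + t * h ^ 2 + t ^ 2 * h ^ 2) *
        ((if resonance p.1 p.2.1 p.2.2 K = 0 then t else 0) +
          |resonance p.1 p.2.1 p.2.2 K|⁻¹) := by
      intro p hp
      rw [Finset.mem_filter] at hp
      obtain ⟨hpT, hpK⟩ := hp
      obtain ⟨b₁, b₂, b₃⟩ := hTn p hpT
      simp only [hX, if_pos hpK]
      exact norm_integral_packet_sub_le hh (by linarith) hσ hr hR ht htσ b₁ b₂ b₃ hpK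
    refine (Finset.sum_le_sum hbd).trans ?_
    rw [← Finset.mul_sum]
    have := sum_resonant_le (by linarith : 3 ≤ L) hR ht hK
    calc _ ≤ 2000 * R ^ 2 * (h ^ 2 / σ ^ 2 + t * h ^ 2 + t ^ 2 * h ^ 2) *
        (2016 * R ^ 2 * (2 + Real.log (4 * R)) ^ 2 *
        (t * L ^ 2 * Real.log L + L ^ 4 * Real.log L ^ 2)) := by gcongr
      _ = _ := by ring

/-- One constant, depending on `η` through a sup bound and a support radius only, serves both as
prefactor and in the exponent. This is the common source of both parts. -/
lemma exists_norm_remainder_le {η : Plane → ℂ} (hη : ContDiff ℝ (⊤ : ℕ∞) η)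
    (hsupp : HasCompactSupport η) :
    ∃ C : ℝ, 0 < C ∧ ∀ {h L σ t : ℝ} {K : Plane}, 0 < h → 200 ≤ L → 0 < σ → 16 * h ≤ σ →
      0 ≤ t → t ≤ 1 / (σ ^ 2 * L ^ 2) → K ∈ lattice L →
      ‖remainder η h L σ K t‖ ≤
        C * L ^ 6 * Real.exp (-(1 / (2 * σ ^ 2 * L ^ 2)) + C * (t + h ^ 2 / σ ^ 4)) +
        C * (h ^ 2 / σ ^ 2 + t * h ^ 2 + t ^ 2 * h ^ 2) *
            (t * L ^ 2 * Real.log L + L ^ 4 * Real.log L ^ 2) := by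
  obtain ⟨M, hM⟩ := hη.continuous.bounded_above_of_compact_support hsupp
  obtain ⟨R₀, hR₀⟩ := hsupp.isCompact.isBounded.exists_norm_le
  set R := max R₀ 1 with hR
  have hR1 : 1 ≤ R := le_max_right _ _
  have hη0 : ∀ K, R < ‖K‖ → η K = 0 := by
    intro K hK
    by_contra hne
    have := hR₀ K (subset_tsupport η hne)
    exact absurd (this.trans (le_max_left R₀ 1)) (not_le.2 hK)
  have hM0 : 0 ≤ M := (norm_nonneg _).trans (hM 0)
  set a := M ^ 3 * (1458 * R ^ 6) with ha
  set b := M ^ 3 * (4032000 * R ^ 4 * (2 + Real.log (4 * R)) ^ 2) with hb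
  have ha0 : 0 ≤ a := by positivity
  have hb0 : 0 ≤ b := by positivity
  have hR2 : 1 ≤ R ^ 2 := one_le_pow₀ hR1
  refine ⟨a + b + 20000 * R ^ 2, by positivity, ?_⟩
  intro h L σ t K hh hL hσ hr ht htσ hK
  refine (norm_remainder_le hM hR1 hη0 hh hL hσ hr ht htσ hK).trans ?_
  have hlog : 0 ≤ Real.log L := Real.log_nonneg (by linarith)
  have i1 : a ≤ a + b + 20000 * R ^ 2 := by linarith
  have i2 : b ≤ a + b + 20000 * R ^ 2 := by linarith
  have i3 : 20000 * R ^ 2 ≤ a + b + 20000 * R ^ 2 := by linarith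
  calc _ = a * L ^ 6 * Real.exp (-(1 / (2 * σ ^ 2 * L ^ 2)) +
          20000 * R ^ 2 * (t + h ^ 2 / σ ^ 4)) +
        b * (h ^ 2 / σ ^ 2 + t * h ^ 2 + t ^ 2 * h ^ 2) *
            (t * L ^ 2 * Real.log L + L ^ 4 * Real.log L ^ 2) := by rw [ha, hb]; ring
    _ ≤ _ := by gcongr

/-! ### The asymptotic regime -/

/-- Elementary consequences of the asymptotic regime. -/
lemma AsymptoticRegime.eventually {ι : Type*} {l : Filter ι} {h L σ : ι → ℝ}
    (H : AsymptoticRegime l h L σ) {ε A : ℝ} (hε : 0 < ε) :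
    ∀ᶠ i in l, 0 < h i ∧ 0 < σ i ∧ A ≤ L i ∧ 1 ≤ L i ∧ h i * L i ≤ ε * σ i ∧
      h i * L i ^ 4 ≤ 1 ∧ σ i ^ 2 * L i ^ 2 ≤ h i := by
  obtain ⟨δ₀, hδ₀, htr⟩ := H.truncation
  filter_upwards [H.pos, H.large.eventually_ge_atTop A, H.large.eventually_ge_atTop 1, htr,
    H.lower.bound hε, H.upper] with i hpos hA h1 htr hlow hup
  obtain ⟨hh, hL, hσ⟩ := hpos
  rw [Real.norm_of_nonneg (by positivity), Real.norm_of_nonneg hσ.le] at hlow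
  have hhL : h i * L i ^ 4 ≤ 1 := by
    refine le_trans ?_ htr
    gcongr
    rw [← Real.rpow_natCast (L i) 4]
    exact Real.rpow_le_rpow_of_exponent_le h1 (by push_cast; linarith)
  refine ⟨hh, hσ, hA, h1, hlow, hhL, ?_⟩
  -- From σ ≤ h^{3/4} one has σ⁴ ≤ h³, hence (σ²L²)² ≤ h³L⁴ ≤ h².
  have hσ4 : σ i ^ 4 ≤ h i ^ 3 := by
    calc σ i ^ 4 ≤ (h i ^ (3 / 4 : ℝ)) ^ 4 := by gcongr
      _ = h i ^ 3 := by
        rw [← Real.rpow_natCast, ← Real.rpow_mul hh.le, ← Real.rpow_natCast (h i) 3]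
        norm_num
  refine le_of_sq_le_sq ?_ hh.le
  calc (σ i ^ 2 * L i ^ 2) ^ 2 = σ i ^ 4 * L i ^ 4 := by ring
    _ ≤ h i ^ 3 * L i ^ 4 := by gcongr
    _ = h i ^ 2 * (h i * L i ^ 4) := by ring
    _ ≤ h i ^ 2 * 1 := by gcongr
    _ = h i ^ 2 := mul_one _

lemma log_sq_le_rpow {δ L : ℝ} (hδ : 0 < δ) (hL : 1 ≤ L) :
    Real.log L ^ 2 ≤ (2 / δ) ^ 2 * L ^ δ := by
  have h1 := Real.log_le_rpow_div (x := L) (by linarith) (half_pos hδ)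
  have h0 : 0 ≤ Real.log L := Real.log_nonneg hL
  calc Real.log L ^ 2 ≤ (L ^ (δ / 2) / (δ / 2)) ^ 2 := by gcongr
    _ = (2 / δ) ^ 2 * (L ^ (δ / 2) * L ^ (δ / 2)) := by field_simp
    _ = (2 / δ) ^ 2 * L ^ δ := by rw [← Real.rpow_add (by linarith), add_halves]

/-- Only the factor log² L costs a constant depending on δ. The constant C is therefore fixed before
δ. -/
lemma eventually_norm_remainder_le {η : Plane → ℂ} {C : ℝ} (hC : 0 < C)
    (hbound : ∀ {h L σ t : ℝ} {K : Plane}, 0 < h → 200 ≤ L → 0 < σ → 16 * h ≤ σ →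
      0 ≤ t → t ≤ 1 / (σ ^ 2 * L ^ 2) → K ∈ lattice L →
      ‖remainder η h L σ K t‖ ≤
        C * L ^ 6 * Real.exp (-(1 / (2 * σ ^ 2 * L ^ 2)) + C * (t + h ^ 2 / σ ^ 4)) +
        C * (h ^ 2 / σ ^ 2 + t * h ^ 2 + t ^ 2 * h ^ 2) *
            (t * L ^ 2 * Real.log L + L ^ 4 * Real.log L ^ 2))
    {δ : ℝ} (hδ : 0 < δ) {ι : Type*} {l : Filter ι} {h L σ : ι → ℝ}
    (H : AsymptoticRegime l h L σ) :
    ∀ᶠ i in l, ∀ K ∈ lattice (L i), ∀ t : ℝ, 0 ≤ t → t ≤ 1 / (σ i ^ 2 * L i ^ 2) →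
      ‖remainder η (h i) (L i) (σ i) K t‖ ≤
        C * L i ^ 6 *
            Real.exp (-(1 / (2 * σ i ^ 2 * L i ^ 2)) + C * (t + h i ^ 2 / σ i ^ 4))
          + C * t * L i ^ 2 * Real.log (L i) *
            (h i ^ 2 / σ i ^ 2 + t * σ i ^ 2 + t ^ 2 * h i ^ 2 + t ^ 3 * σ i ^ 4)
          + C * (2 / δ) ^ 2 * L i ^ (4 + δ) *
            (h i ^ 2 / σ i ^ 2 + t * σ i ^ 2 + t ^ 2 * σ i ^ 2 + t ^ 3 * σ i ^ 4) := by
  filter_upwards [H.eventually (A := 200) (show (0 : ℝ) < 1 by norm_num)] with i hi K hK t ht htσ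
  obtain ⟨hh, hσ, hL, hL1, hlow, -, -⟩ := hi
  have hr : 16 * h i ≤ σ i := by nlinarith
  have hhσ : h i ^ 2 ≤ σ i ^ 2 := by gcongr; linarith
  refine (hbound hh hL hσ hr ht htσ hK).trans ?_
  have hlog : 0 ≤ Real.log (L i) := Real.log_nonneg hL1
  have hE1 : h i ^ 2 / σ i ^ 2 + t * h i ^ 2 + t ^ 2 * h i ^ 2 ≤
      h i ^ 2 / σ i ^ 2 + t * σ i ^ 2 + t ^ 2 * h i ^ 2 + t ^ 3 * σ i ^ 4 := by
    have : t * h i ^ 2 ≤ t * σ i ^ 2 := by gcongr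
    have : 0 ≤ t ^ 3 * σ i ^ 4 := by positivity
    linarith
  have hE2 : h i ^ 2 / σ i ^ 2 + t * h i ^ 2 + t ^ 2 * h i ^ 2 ≤
      h i ^ 2 / σ i ^ 2 + t * σ i ^ 2 + t ^ 2 * σ i ^ 2 + t ^ 3 * σ i ^ 4 := by
    have : t * h i ^ 2 ≤ t * σ i ^ 2 := by gcongr
    have : t ^ 2 * h i ^ 2 ≤ t ^ 2 * σ i ^ 2 := by gcongr
    have : 0 ≤ t ^ 3 * σ i ^ 4 := by positivity
    linarith
  have hpow : L i ^ 4 * Real.log (L i) ^ 2 ≤ (2 / δ) ^ 2 * L i ^ (4 + δ) := by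
    have e : L i ^ (4 + δ) = L i ^ 4 * L i ^ δ := by
      rw [Real.rpow_add (by linarith), Real.rpow_ofNat]
    rw [e]
    calc _ ≤ L i ^ 4 * ((2 / δ) ^ 2 * L i ^ δ) := by gcongr; exact log_sq_le_rpow hδ hL1
      _ = _ := by ring
  rw [mul_add (C * (_ + _)), ← add_assoc]
  refine add_le_add (add_le_add le_rfl ?_) ?_
  · calc _ = C * t * L i ^ 2 * Real.log (L i) *
          (h i ^ 2 / σ i ^ 2 + t * h i ^ 2 + t ^ 2 * h i ^ 2) := by ring
      _ ≤ _ := by gcongr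
  · calc _ ≤ C * (h i ^ 2 / σ i ^ 2 + t * σ i ^ 2 + t ^ 2 * σ i ^ 2 + t ^ 3 * σ i ^ 4) *
          ((2 / δ) ^ 2 * L i ^ (4 + δ)) := by gcongr
      _ = _ := by ring

/-- For small ε the exponent is at most -Y/4, and Y ≥ 1/h ≥ L⁴. Even the crude bound exp(-Y/4) ≤
4/L⁴ turns L⁶ into O(L²), which is smaller than εL⁴ once εL ≥ 1. -/
lemma exponential_error_le {C h L σ t ε Y : ℝ} (hC : 0 < C) (hh : 0 < h) (hσ : 0 < σ)
    (hL1 : 1 ≤ L) (hY : Y = 1 / (σ ^ 2 * L ^ 2)) (hε : 0 < ε) (hε1 : ε ≤ 1 / 16)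
    (hεC : C * (2 * ε) ≤ 1 / 4) (hYt : t ≤ ε * Y) (hinv : 1 / h ≤ Y)
    (hhσ : h ^ 2 / σ ^ 2 ≤ ε ^ 2 * (1 / L ^ 2)) (hεL : 1 ≤ ε * L) (hhL : h * L ^ 4 ≤ 1) :
    C * L ^ 6 * Real.exp (-(1 / (2 * σ ^ 2 * L ^ 2)) + C * (t + h ^ 2 / σ ^ 4)) ≤
      4 * C * ε * L ^ 4 := by
  have hL0 : 0 < L := by linarith
  have hY0 : 0 < Y := by rw [hY]; positivity
  have e1 : 1 / (2 * σ ^ 2 * L ^ 2) = Y / 2 := by rw [hY]; field_simp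
  have e2 : h ^ 2 / σ ^ 4 ≤ ε * Y := by
    have : h ^ 2 / σ ^ 4 = h ^ 2 / σ ^ 2 * (1 / σ ^ 2) := by field_simp
    rw [this]
    calc _ ≤ ε ^ 2 * (1 / L ^ 2) * (1 / σ ^ 2) := by gcongr
      _ = ε * (ε * Y) := by rw [hY]; field_simp
      _ ≤ 1 * (ε * Y) := by gcongr; linarith
      _ = _ := one_mul _
  have e3 : -(Y / 2) + C * (t + h ^ 2 / σ ^ 4) ≤ -(Y / 4) := by
    have : C * (t + h ^ 2 / σ ^ 4) ≤ C * (2 * ε) * Y := by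
      calc _ ≤ C * (ε * Y + ε * Y) := by gcongr
        _ = _ := by ring
    nlinarith
  have e4 : L ^ 4 ≤ Y := by
    refine le_trans ?_ hinv
    rw [le_div_iff₀ hh]
    linarith
  have e5 : Real.exp (-(Y / 4)) ≤ 4 / L ^ 4 := by
    rw [Real.exp_neg, inv_le_comm₀ (Real.exp_pos _) (by positivity), inv_div]
    have := Real.add_one_le_exp (Y / 4)
    linarith
  rw [e1]
  calc _ ≤ C * L ^ 6 * (4 / L ^ 4) := by
        gcongr
        exact (Real.exp_le_exp.2 e3).trans e5
    _ = 4 * C * (1 * L) * L := by field_simp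
    _ ≤ 4 * C * (ε * L * L) * L := by gcongr
    _ = 4 * C * ε * L ^ 3 := by ring
    _ ≤ 4 * C * ε * L ^ 4 := by
      gcongr
      norm_num

/-- The bound log L ≤ L suffices. In the product with L⁴ log² L, the terms h²/σ² and th² are
compared with L⁴, while t²h² is compared with tL² log L: their ratio is (th)(hL²) log L ≤ ε/L. -/
lemma polynomial_error_le {h L σ t ε : ℝ} (hh : 0 < h) (hL1 : 1 ≤ L) (ht : 0 ≤ t)
    (hε : 0 < ε) (hε1 : ε ≤ 1 / 16) (hth : t * h ≤ ε)
    (hhσ : h ^ 2 / σ ^ 2 ≤ ε ^ 2 * (1 / L ^ 2)) (hhL2 : h * L ^ 2 ≤ 1 / L ^ 2) :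
    (h ^ 2 / σ ^ 2 + t * h ^ 2 + t ^ 2 * h ^ 2) *
        (t * L ^ 2 * Real.log L + L ^ 4 * Real.log L ^ 2) ≤
      4 * ε * (t * L ^ 2 * Real.log L + L ^ 4) := by
  have hL0 : 0 < L := by linarith
  have hlog : 0 ≤ Real.log L := Real.log_nonneg hL1
  have hlogL : Real.log L ≤ L := (Real.log_le_sub_one_of_pos hL0).trans (by linarith)
  have hL2 : 1 ≤ L ^ 2 := one_le_pow₀ hL1
  have hinvL : 1 / L ^ 2 ≤ 1 := by rw [div_le_one (by positivity)]; exact hL2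
  have hg1 : 0 ≤ t * L ^ 2 * Real.log L := by positivity
  have hh1 : h ≤ 1 := by nlinarith
  have hεε : ε ^ 2 ≤ ε := by nlinarith
  have f1 : h ^ 2 / σ ^ 2 ≤ ε := by
    calc _ ≤ ε ^ 2 * (1 / L ^ 2) := hhσ
      _ ≤ ε ^ 2 * 1 := by gcongr
      _ ≤ ε := by linarith
  have f2 : t * h ^ 2 ≤ ε := by
    calc t * h ^ 2 = t * h * h := by ring
      _ ≤ ε * 1 := by gcongr
      _ = ε := mul_one _
  have f3 : t ^ 2 * h ^ 2 ≤ ε := by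
    calc t ^ 2 * h ^ 2 = (t * h) ^ 2 := by ring
      _ ≤ ε ^ 2 := by gcongr
      _ ≤ ε := hεε
  have g1 : L ^ 4 * Real.log L ^ 2 * (h ^ 2 / σ ^ 2) ≤ ε * L ^ 4 := by
    calc _ ≤ L ^ 4 * L ^ 2 * (ε ^ 2 * (1 / L ^ 2)) := by gcongr
      _ = ε ^ 2 * L ^ 4 := by field_simp
      _ ≤ ε * L ^ 4 := by gcongr
  have g2 : L ^ 4 * Real.log L ^ 2 * (t * h ^ 2) ≤ ε * L ^ 4 := by
    calc _ = L ^ 4 * Real.log L ^ 2 * ((t * h) * h) := by ring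
      _ ≤ L ^ 4 * L ^ 2 * (ε * h) := by gcongr
      _ = ε * L ^ 4 * (h * L ^ 2) := by ring
      _ ≤ ε * L ^ 4 * 1 := by gcongr; exact hhL2.trans hinvL
      _ = _ := mul_one _
  have g3 : L ^ 4 * Real.log L ^ 2 * (t ^ 2 * h ^ 2) ≤ ε * (t * L ^ 2 * Real.log L) := by
    have : (t * h) * (h * L ^ 2) * Real.log L ≤ ε := by
      calc _ ≤ ε * (1 / L ^ 2) * L := by gcongr
        _ = ε * (1 / L) := by field_simp
        _ ≤ ε * 1 := by gcongr; rw [div_le_one hL0]; exact hL1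
        _ = ε := mul_one _
    calc _ = (t * h) * (h * L ^ 2) * Real.log L * (t * L ^ 2 * Real.log L) := by ring
      _ ≤ _ := by gcongr
  have g4 := mul_le_mul_of_nonneg_right (add_le_add (add_le_add f1 f2) f3) hg1
  have : 0 ≤ ε * L ^ 4 := by positivity
  linarith

/-- Since 1/h ≤ 1/(σ²L²), the assumption t ≪ 1/h implies t ≤ 1/(σ²L²) eventually, so the explicit
bound applies. The parameter ε is chosen so that the two error contributions add up to at most 8Cε ≤
c times the target. -/
lemma remainder_isLittleO {η : Plane → ℂ} {C : ℝ} (hC : 0 < C)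
    (hbound : ∀ {h L σ t : ℝ} {K : Plane}, 0 < h → 200 ≤ L → 0 < σ → 16 * h ≤ σ →
      0 ≤ t → t ≤ 1 / (σ ^ 2 * L ^ 2) → K ∈ lattice L →
      ‖remainder η h L σ K t‖ ≤
        C * L ^ 6 * Real.exp (-(1 / (2 * σ ^ 2 * L ^ 2)) + C * (t + h ^ 2 / σ ^ 4)) +
        C * (h ^ 2 / σ ^ 2 + t * h ^ 2 + t ^ 2 * h ^ 2) *
            (t * L ^ 2 * Real.log L + L ^ 4 * Real.log L ^ 2))
    {ι : Type*} {l : Filter ι} {h L σ t : ι → ℝ} {K : ι → Plane}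
    (H : AsymptoticRegime l h L σ) (hK : ∀ᶠ i in l, K i ∈ lattice (L i))
    (ht : ∀ᶠ i in l, 0 ≤ t i) (hth : t =o[l] fun i => 1 / h i) :
    (fun i => remainder η (h i) (L i) (σ i) (K i) (t i)) =o[l]
      fun i => t i * L i ^ 2 * Real.log (L i) + L i ^ 4 := by
  rw [isLittleO_iff]
  intro c hc
  obtain ⟨ε, hε, hε1, hεC, hεc⟩ : ∃ ε : ℝ, 0 < ε ∧ ε ≤ 1 / 16 ∧ C * (2 * ε) ≤ 1 / 4 ∧
      12 * C * ε ≤ c := by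
    refine ⟨min (1 / 16) (min (1 / (8 * C)) (c / (12 * C))), by positivity, min_le_left _ _,
      ?_, ?_⟩
    · have : min (1 / 16) (min (1 / (8 * C)) (c / (12 * C))) ≤ 1 / (8 * C) :=
        (min_le_right _ _).trans (min_le_left _ _)
      calc _ ≤ C * (2 * (1 / (8 * C))) := by gcongr
        _ = 1 / 4 := by field_simp; norm_num
    · have : min (1 / 16) (min (1 / (8 * C)) (c / (12 * C))) ≤ c / (12 * C) :=
        (min_le_right _ _).trans (min_le_right _ _)
      calc _ ≤ 12 * C * (c / (12 * C)) := by gcongr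
        _ = c := by field_simp
  filter_upwards [H.eventually (A := max 200 (1 / ε)) hε, hK, ht, hth.bound hε] with i hi hK ht hth
  obtain ⟨hh, hσ, hLA, hL1, hlow, hhL, hσh⟩ := hi
  have hL : 200 ≤ L i := (le_max_left _ _).trans hLA
  have hLε : 1 / ε ≤ L i := (le_max_right _ _).trans hLA
  generalize h i = h at *
  generalize L i = L at *
  generalize σ i = σ at *
  generalize t i = t at *
  generalize K i = K at *
  have hL0 : 0 < L := by linarith
  rw [Real.norm_of_nonneg ht, Real.norm_of_nonneg (by positivity)] at hth
  have hth' : t * h ≤ ε := by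
    calc t * h ≤ ε * (1 / h) * h := by gcongr
      _ = ε := by field_simp
  have hinv : 1 / h ≤ 1 / (σ ^ 2 * L ^ 2) := one_div_le_one_div_of_le (by positivity) hσh
  set Y := 1 / (σ ^ 2 * L ^ 2) with hY
  have hY0 : 0 < Y := by positivity
  have hYt : t ≤ ε * Y := hth.trans (by gcongr)
  have hr : 16 * h ≤ σ := by nlinarith
  have htσ : t ≤ Y := by nlinarith
  have hhσ : h ^ 2 / σ ^ 2 ≤ ε ^ 2 * (1 / L ^ 2) := by
    rw [div_le_iff₀ (by positivity)]
    have h1 : h ≤ ε * σ / L := by rw [le_div_iff₀ hL0]; exact hlow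
    calc h ^ 2 ≤ (ε * σ / L) ^ 2 := by gcongr
      _ = _ := by field_simp
  have hlog : 0 ≤ Real.log L := Real.log_nonneg hL1
  have hεL : 1 ≤ ε * L := by rwa [div_le_iff₀' hε] at hLε
  have hhL2 : h * L ^ 2 ≤ 1 / L ^ 2 := by
    rw [le_div_iff₀ (by positivity)]
    calc _ = h * L ^ 4 := by ring
      _ ≤ 1 := hhL
  set g := t * L ^ 2 * Real.log L + L ^ 4 with hg
  have hg1 : 0 ≤ t * L ^ 2 * Real.log L := by positivity
  have hg2 : 0 ≤ L ^ 4 := by positivity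
  refine (hbound hh hL hσ hr ht htσ hK).trans ?_
  rw [Real.norm_of_nonneg (by positivity)]
  have hexp := exponential_error_le hC hh hσ hL1 hY hε hε1 hεC hYt hinv hhσ hεL hhL
  have hE := polynomial_error_le hh hL1 ht hε hε1 hth' hhσ hhL2
  rw [← hg] at hE
  calc _ ≤ 4 * C * ε * L ^ 4 + C * (4 * ε * g) := by
        refine add_le_add hexp ?_
        rw [mul_assoc]
        gcongr
    _ ≤ 8 * C * ε * g := by
        have : 0 ≤ C * ε * (t * L ^ 2 * Real.log L) := by positivity
        rw [hg]; linarith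
    _ ≤ c * g := by
        have : 0 ≤ C * ε := by positivity
        gcongr
        linarith

end

end CoarseNLS

theorem proposition4p3 (η : CoarseNLS.Plane → ℂ) (hη : ContDiff ℝ (⊤ : ℕ∞) η)
    (hsupp : HasCompactSupport η) :
    ∃ r : (h L σ : ℝ) → (K : CoarseNLS.Plane) → (t : ℝ) → ℂ,
      -- the expansion, which defines the remainder
      (∀ h L σ t : ℝ, 0 < h → 0 < L → 0 < σ → 0 ≤ t → ∀ K ∈ CoarseNLS.lattice L,
        CoarseNLS.coarse (CoarseNLS.firstOrder (CoarseNLS.initialDatum η h L) t) K σ =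
          (1 / (2 * (Real.pi : ℂ)) ^ 4) * CoarseNLS.interactionSum η L K t + r h L σ K t) ∧
      -- the explicit bound
      (∃ C : ℝ, 0 < C ∧ ∀ δ : ℝ, 0 < δ → ∃ C' : ℝ, 0 < C' ∧
        ∀ (ι : Type*) (l : Filter ι) (h L σ : ι → ℝ), CoarseNLS.AsymptoticRegime l h L σ →
          ∀ᶠ i in l, ∀ K ∈ CoarseNLS.lattice (L i), ∀ t : ℝ,
            0 ≤ t → t ≤ 1 / (σ i ^ 2 * L i ^ 2) →
            ‖r (h i) (L i) (σ i) K t‖ ≤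
              C * L i ^ 6 *
                  Real.exp (-(1 / (2 * σ i ^ 2 * L i ^ 2)) + C * (t + h i ^ 2 / σ i ^ 4))
                + C * t * L i ^ 2 * Real.log (L i) *
                  (h i ^ 2 / σ i ^ 2 + t * σ i ^ 2 + t ^ 2 * h i ^ 2 + t ^ 3 * σ i ^ 4)
                + C' * L i ^ (4 + δ) *
                  (h i ^ 2 / σ i ^ 2 + t * σ i ^ 2 + t ^ 2 * σ i ^ 2 + t ^ 3 * σ i ^ 4)) ∧
      -- the smallness of the remainder for `t ≪ 1 / h`
      (∀ (ι : Type*) (l : Filter ι) (h L σ t : ι → ℝ) (K : ι → CoarseNLS.Plane),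
        CoarseNLS.AsymptoticRegime l h L σ →
        (∀ᶠ i in l, K i ∈ CoarseNLS.lattice (L i)) →
        (∀ᶠ i in l, 0 ≤ t i) →
        (t =o[l] fun i => 1 / h i) →
        (fun i => r (h i) (L i) (σ i) (K i) (t i)) =o[l]
          fun i => t i * L i ^ 2 * Real.log (L i) + L i ^ 4) := by
  obtain ⟨C, hC, hbound⟩ := CoarseNLS.exists_norm_remainder_le hη hsupp
  refine ⟨CoarseNLS.remainder η, ?_, ⟨C, hC, fun δ hδ => ⟨C * (2 / δ) ^ 2, by positivity, ?_⟩⟩, ?_⟩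
  · intro h L σ t _ _ _ _ K _
    rw [CoarseNLS.remainder, add_sub_cancel]
  · intro ι l h L σ H
    exact CoarseNLS.eventually_norm_remainder_le hC hbound hδ H
  · intro ι l h L σ t K H hK ht hth
    exact CoarseNLS.remainder_isLittleO hC hbound H hK ht hth
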